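/- **Setting.** In the infinitely-armed deterministic bandit there is a countably infinite set of actions $\mathcal A=\{1,2,\dots\}$. The rewards $(\theta_a)_{a\in\mathcal A}$ are independent and uniform on $[0,1]$. Playing $a$ at time $t\in\mathbb N_0=\{0,1,2,\dots\}$ yields and reveals $R_{t,a}=Y_{t,a}=\theta_a$, and $R^*=\sup_a\theta_a$. Let $\xi$ be a random variable with values in a standard Borel space, independent of $\theta$. For an action process $(A_t)$ put $\mathcal F_t=(A_0,Y_{0,A_0},\dots,A_{t-1},Y_{t-1,A_{t-1}})$ and write $\mathbf P_t=\mathbf P(\cdot\mid\mathcal F_t)$, $\mathbf E_t=\mathbf E[\cdot\mid\mathcal F_t]$. Satisficing Thompson sampling (STS) with tolerance $\epsilon$ and internal randomness $\xi$ acts as follows in period $t$. It draws, as a function of $(\mathcal F_t,\xi)$, a sample $\hat\theta_t\sim\mathbf P(\theta\mid\mathcal F_t)$. If $\hat\theta_{t,A_k}+\epsilon\ge\sup_a\hat\theta_{t,a}$ for some $k<t$, it plays $A_t=A_k$ for the smallest such $k$. Otherwise it plays an action that has not been played before; since $\sup_a\hat\theta_{t,a}$ is almost surely not attained, this new action is designated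 by the internal randomness, that is, it is a function of $(A_0,\dots,A_{t-1})$ and $\xi$ only. Entropies and mutual informations are taken with the natural logarithm. For an action process $(A_t)$ and a random action $\tilde A$ let $$\mathbf\Gamma(\tilde A,\{A_t\})=(1-\alpha^2)\sum_{t=0}^\infty\alpha^{2t}\,\mathbf E\left[\frac{\mathbf E_t[\theta_{\tilde A}-\theta_{A_t}]^2}{\mathbf I_t(\tilde A;Y_{t,A_t}\mid\xi)}\right]\in[0,\infty],$$ where $\mathbf I_t(\,\cdot\,;\cdot\mid\xi)$ is conditional mutual information given $\xi$ under $\mathbf P_t$, with the conventions $0/0=0$ and $x/0=\infty$ for $x>0$. **Theorem.** Let $\alpha\in(0,1)$ and $\epsilon\in(0,1)$, let $(A_t)_{t\in\mathbb N_0}$ be generated by STS with tolerance $\epsilon$ in the infinitely-armed deterministic bandit, and let $\tau=\min\{t:\theta_{A_t}\ge 1-\epsilon\}$ and $\tilde A=A_\tau$. Then $\tau$ is almost surely finite and geometric with parameter $\epsilon$, i.e. $\mathbf P(\tau=k)=\epsilon(1-\epsilon)^k$ for $k=0,1,2,\dots$; moreover $0<\mathbf H(\tau)<\infty$, and $$\mathbf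 H(\tilde A\mid\xi)=\mathbf H(\tau),\qquad \mathbf\Gamma(\tilde A,\{A_t\})\le\frac{1}{4\epsilon\,\mathbf H(\tau)}.$$ If in addition $\epsilon=\sqrt{(1-\alpha)/2}$, then $\sum_{t\ge0}\alpha^t(R^*-R_{t,A_t})$ converges almost surely and is integrable, and $$\mathbf E\left[\sum_{t=0}^\infty\alpha^t(R^*-R_{t,A_t})\right]\le\sqrt{\frac{2}{1-\alpha}}.$$ -/

import Mathlib

open MeasureTheory ProbabilityTheory
open scoped ENNReal

noncomputable section

namespace SatisficingBandit

/-! ### Entropy and conditional mutual information (natural logarithms, values in `[0, ∞]`) -/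

/-- Shannon entropy `- ∑ p(s) log p(s)` of a probability measure on a countable space. -/
def entropyOfLaw {S : Type*} [MeasurableSpace S] (p : Measure S) : ℝ≥0∞ :=
  ∑' s : S, ENNReal.ofReal (Real.negMulLog (p.real {s}))

/-- Entropy `H(X)` of a discrete random variable. -/
def entropy {Ω S : Type*} [MeasurableSpace Ω] [MeasurableSpace S] (μ : Measure Ω)
    (X : Ω → S) : ℝ≥0∞ :=
  entropyOfLaw (μ.map X)

/-- Conditional entropy `H(X | Z)`: the average over `z` of the entropy of the conditional law of
the discrete random variable `X` given `Z = z`. -/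
def condEntropy {Ω S Z : Type*} [MeasurableSpace Ω] [MeasurableSpace S] [StandardBorelSpace S]
    [Nonempty S] [MeasurableSpace Z] (μ : Measure Ω) [IsFiniteMeasure μ]
    (X : Ω → S) (W : Ω → Z) : ℝ≥0∞ :=
  ∫⁻ z, entropyOfLaw (condDistrib X W μ z) ∂(μ.map W)

/-- Conditional mutual information `I(X; Y | Z)` as a functional of the law `ρ` of `(Z, (X, Y))`:
the average over `z` of the Kullback-Leibler divergence between the conditional law of `(X, Y)`
given `Z = z` and the product of its two marginals. -/
def condMutualInfoOfLaw {S T Z : Type*} [MeasurableSpace S] [StandardBorelSpace S] [Nonempty S]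
    [MeasurableSpace T] [StandardBorelSpace T] [Nonempty T] [MeasurableSpace Z]
    (ρ : Measure (Z × (S × T))) [IsFiniteMeasure ρ] : ℝ≥0∞ :=
  ∫⁻ z, InformationTheory.klDiv (ρ.condKernel z)
    ((ρ.condKernel z).fst.prod (ρ.condKernel z).snd) ∂ρ.fst

/-! ### The infinitely-armed deterministic bandit

Actions are labelled by `ℕ`, the reward of action `a` is `θ a`, and playing `a` reveals `θ a`, so
that the outcome at time `t` (and that of an independent copy given `θ`) is `Y_{t,a} = θ a`. -/

/-- The mean rewards are independent and uniform on `[0, 1]`, and the exogenous random variable `ξ`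
is independent of them. -/
structure IsDeterministicBandit {Ω Ξ : Type*} [MeasurableSpace Ω] [MeasurableSpace Ξ]
    (μ : Measure Ω) (θ : ℕ → Ω → ℝ) (ξ : Ω → Ξ) : Prop where
  measurable_reward : ∀ a, Measurable (θ a)
  uniform : ∀ a, pdf.IsUniform (θ a) (Set.Icc 0 1) μ
  indep : iIndepFun θ μ
  measurable_exogenous : Measurable ξ
  indep_exogenous : IndepFun ξ (fun ω a => θ a ω) μ

/-- Values of the history `F_t = (A_0, Y_{0,A_0}, …, A_{t-1}, Y_{t-1,A_{t-1}})`. -/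
abbrev History (t : ℕ) : Type := Fin t → ℕ × ℝ

/-- The history `F_t` of the action process `A`. -/
def history {Ω : Type*} (θ : ℕ → Ω → ℝ) (A : ℕ → Ω → ℕ) (t : ℕ) (ω : Ω) : History t :=
  fun k => (A k ω, θ (A k ω) ω)

/-- The optimal reward `R* = sup_a θ_a`. -/
def optReward {Ω : Type*} (θ : ℕ → Ω → ℝ) (ω : Ω) : ℝ := ⨆ a, θ a ω

/-- The previously played action `A_k` is `ε`-optimal for the sampled model `v`. -/
def Satisfactory {Ω : Type*} (ε : ℝ) (A : ℕ → Ω → ℕ) (v : ℕ → ℝ) (ω : Ω) (k : ℕ) : Prop :=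
  (⨆ a, v a) ≤ v (A k ω) + ε

/-- `A` is generated by satisficing Thompson sampling with tolerance `ε`, with internal
randomness `ξ`. In period `t`:

* a model `sample t (F_t, ξ)` is drawn from the posterior distribution of `θ` given `F_t`;
* if some action `A_k`, `k < t`, is within `ε` of the optimum in the sampled model, the one with
  the smallest `k` is played;
* otherwise an action which has not been played before is played. As the supremum of the sampled
  model is almost surely not attained, the algorithm's internal randomness designates which one:
  it depends on the actions played so far and on `ξ`, and not on the observed rewards. -/
def IsSTS {Ω Ξ : Type*} [MeasurableSpace Ω] [MeasurableSpace Ξ]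
    (μ : Measure Ω) [IsFiniteMeasure μ] (θ : ℕ → Ω → ℝ) (ξ : Ω → Ξ) (ε : ℝ)
    (A : ℕ → Ω → ℕ) : Prop :=
  ∃ (sample : ∀ t, History t × Ξ → ℕ → ℝ) (fresh : ∀ t, (Fin t → ℕ) × Ξ → ℕ),
    (∀ t, Measurable (sample t)) ∧
    (∀ t, Measurable (fresh t)) ∧
    (∀ t past x, ∀ k : Fin t, fresh t (past, x) ≠ past k) ∧
    (∀ t, condDistrib (fun ω => sample t (history θ A t ω, ξ ω)) (history θ A t) μ
        =ᵐ[μ.map (history θ A t)]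
      condDistrib (fun ω a => θ a ω) (history θ A t) μ) ∧
    (∀ t ω, ∀ k < t,
      Satisfactory ε A (sample t (history θ A t ω, ξ ω)) ω k →
      (∀ j < k, ¬ Satisfactory ε A (sample t (history θ A t ω, ξ ω)) ω j) →
      A t ω = A k ω) ∧
    (∀ t ω,
      (∀ k < t, ¬ Satisfactory ε A (sample t (history θ A t ω, ξ ω)) ω k) →
      A t ω = fresh t (fun k => A k ω, ξ ω))

/-- `τ = min {t | θ_{A_t} ≥ 1 - ε}` (with value `0` if there is no such `t`). -/
def firstSatisfactory {Ω : Type*} (θ : ℕ → Ω → ℝ) (A : ℕ → Ω → ℕ) (ε : ℝ) (ω : Ω) : ℕ :=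
  sInf {t | 1 - ε ≤ θ (A t ω) ω}

/-- The benchmark action `Ã = A_τ`. -/
def benchmark {Ω : Type*} (θ : ℕ → Ω → ℝ) (A : ℕ → Ω → ℕ) (ε : ℝ) (ω : Ω) : ℕ :=
  A (firstSatisfactory θ A ε ω) ω

/-! ### The modified information ratio -/

/-- `E_t[R̃ - R_{t,A_t}]`, where `R̃ = θ_Ã`. -/
def expectedShortfall {Ω : Type*} [MeasurableSpace Ω] (μ : Measure Ω) (θ : ℕ → Ω → ℝ)
    (A : ℕ → Ω → ℕ) (B : Ω → ℕ) (t : ℕ) : Ω → ℝ :=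
  μ[fun ω => θ (B ω) ω - θ (A t ω) ω |
    MeasurableSpace.comap (history θ A t) inferInstance]

/-- `I_t(Ã; Y_{t,A_t} | ξ)`: the conditional mutual information of `Ã` and `Y_{t,A_t}` given `ξ`,
computed under the posterior distribution `P(· | F_t)`. -/
def informationGain {Ω Ξ : Type*} [MeasurableSpace Ω] [MeasurableSpace Ξ] [StandardBorelSpace Ξ]
    [Nonempty Ξ] (μ : Measure Ω) [IsFiniteMeasure μ] (θ : ℕ → Ω → ℝ) (ξ : Ω → Ξ)
    (A : ℕ → Ω → ℕ) (B : Ω → ℕ) (t : ℕ) (ω : Ω) : ℝ≥0∞ :=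
  condMutualInfoOfLaw
    (condDistrib (fun ω' => (ξ ω', (B ω', θ (A t ω') ω'))) (history θ A t) μ (history θ A t ω))

/-- `Γ(Ã, {A_t}) = (1 - α²) ∑ₜ α^{2t} E[E_t[R̃ - R_{t,A_t}]² / I_t(Ã; Y_{t,A_t} | ξ)]`, in `[0, ∞]`,
with the conventions `0 / 0 = 0` and `x / 0 = ∞` for `x > 0`. -/
def informationRatio {Ω Ξ : Type*} [MeasurableSpace Ω] [MeasurableSpace Ξ] [StandardBorelSpace Ξ]
    [Nonempty Ξ] (μ : Measure Ω) [IsFiniteMeasure μ] (θ : ℕ → Ω → ℝ) (ξ : Ω → Ξ) (α : ℝ)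
    (B : Ω → ℕ) (A : ℕ → Ω → ℕ) : ℝ≥0∞ :=
  ENNReal.ofReal (1 - α ^ 2) * ∑' t : ℕ, ENNReal.ofReal (α ^ (2 * t)) *
    ∫⁻ ω, ENNReal.ofReal (expectedShortfall μ θ A B t ω ^ 2) /
      informationGain μ θ ξ A B t ω ∂μ

end SatisficingBandit

end

/-!
A posterior sample `θ̂_t` has the conditional law of `θ` given the history. Hence almost surely it
agrees with `θ` on the actions already played, and its supremum is `1`, so a played action passes
the test on `θ̂_t` exactly when its true reward is at least `1 - ε`. Satisficing Thompson sampling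
is therefore a sequential search: it tries actions in an order depending on `ξ` alone until it finds
a reward in `[1 - ε, 1]`, and plays that action ever after. Listed in this order the rewards are
still independent and uniform, and independent of `ξ`. So `τ` is geometric, and given `ξ` the
benchmark `Ã` is an injective function of `τ`.

While the search is running, the next reward is uniform given the history and `ξ`, so the expected
shortfall is `(1 - ε) / 2 ≤ 1 / 2`. Observing this reward reveals whether `Ã = A_t`, an event of
conditional probability `ε`, so by data processing the information gained is at least the binary
entropy `h(ε) = ε H(τ)`. Once the search has stopped the shortfall is zero. Finally, the expected
regret in period `t` is at most `ε + (1 - ε)^t / 2`, whose second term sums to `1 / (2ε)`.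
-/

noncomputable section

namespace SatisficingBandit

open InformationTheory

/-! ### Entropy and relative entropy -/

section Entropy

variable {S T R : Type*} [MeasurableSpace S] [MeasurableSpace T] [MeasurableSpace R]

lemma entropyOfLaw_map_of_injective [Countable S] [MeasurableSingletonClass S]
    [MeasurableSingletonClass T] (p : Measure S) {g : S → T} (hg : Function.Injective g) :
    entropyOfLaw (p.map g) = entropyOfLaw p := by
  have hmap (t : T) : (p.map g).real {t} = p.real (g ⁻¹' {t}) :=
    map_measureReal_apply .of_discrete (measurableSet_singleton t)
  have hsupp : (Function.support fun t => ENNReal.ofReal (Real.negMulLog (p.real (g ⁻¹' {t})))) ⊆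
      Set.range g := by
    refine Function.support_subset_iff'.2 fun t ht => ?_
    simp [Set.preimage_singleton_eq_empty.2 ht]
  simp_rw [entropyOfLaw, hmap]
  rw [← hg.tsum_eq hsupp]
  simp_rw [← Set.image_singleton, Set.preimage_image_eq _ hg]

lemma entropyOfLaw_bool (P : Measure Bool) [IsProbabilityMeasure P] :
    entropyOfLaw P = ENNReal.ofReal (Real.binEntropy (P.real {true})) := by
  have hfalse : P.real {false} = 1 - P.real {true} := by
    rw [← probReal_compl_eq_one_sub (measurableSet_singleton true)]
    congr 1
    ext b
    simp
  rw [entropyOfLaw, tsum_bool, hfalse, add_comm, Real.binEntropy_eq_negMulLog_add_negMulLog_one_sub,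
    ENNReal.ofReal_add]
  · exact Real.negMulLog_nonneg measureReal_nonneg measureReal_le_one
  · exact Real.negMulLog_nonneg (sub_nonneg.2 measureReal_le_one)
      (sub_le_self _ measureReal_nonneg)

lemma hasSum_negMulLog_geometric {p : ℝ} (h0 : 0 < p) (h1 : p < 1) :
    HasSum (fun n : ℕ => Real.negMulLog ((1 - p) ^ n * p)) (Real.binEntropy p / p) := by
  have hpos : 0 < 1 - p := sub_pos.2 h1
  have hterm (n : ℕ) : Real.negMulLog ((1 - p) ^ n * p) =
      -(p * Real.log (1 - p)) * (n * (1 - p) ^ n) + -(p * Real.log p) * (1 - p) ^ n := by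
    rw [Real.negMulLog, Real.log_mul (pow_pos hpos n).ne' h0.ne', Real.log_pow]
    ring
  have hvalue : Real.binEntropy p / p = -(p * Real.log (1 - p)) * ((1 - p) / (1 - (1 - p)) ^ 2) +
      -(p * Real.log p) * (1 - (1 - p))⁻¹ := by
    rw [Real.binEntropy, Real.log_inv, Real.log_inv, sub_sub_cancel]
    field_simp
    ring
  have hnorm : ‖1 - p‖ < 1 := by
    rw [Real.norm_of_nonneg hpos.le]
    linarith
  simp_rw [hterm]
  rw [hvalue]
  exact ((hasSum_coe_mul_geometric_of_norm_lt_one hnorm).mul_left _).add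
    ((hasSum_geometric_of_norm_lt_one hnorm).mul_left _)

lemma entropyOfLaw_geometricMeasure {p : unitInterval} (h0 : 0 < p) (h1 : p < 1) :
    entropyOfLaw (geometricMeasure p) = ENNReal.ofReal (Real.binEntropy p / p) := by
  have hnonneg (n : ℕ) : 0 ≤ Real.negMulLog ((geometricMeasure p).real {n}) :=
    Real.negMulLog_nonneg measureReal_nonneg measureReal_le_one
  have hsum := hasSum_negMulLog_geometric (p := p) h0 h1
  simp_rw [← geometricMeasure_real_singleton h0.ne'] at hsum
  rw [entropyOfLaw, ← ENNReal.ofReal_tsum_of_nonneg hnonneg hsum.summable, hsum.tsum_eq]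

lemma klDiv_eq_lintegral_of_llr_nonneg {μ ν : Measure S} [IsProbabilityMeasure μ]
    [IsProbabilityMeasure ν] (hac : μ ≪ ν) (hnonneg : 0 ≤ᵐ[μ] llr μ ν) :
    klDiv μ ν = ∫⁻ s, ENNReal.ofReal (llr μ ν s) ∂μ := by
  by_cases hint : Integrable (llr μ ν) μ
  · simp [klDiv_of_ac_of_integrable hac hint, ofReal_integral_eq_lintegral_ofReal hint hnonneg]
  · rw [klDiv_of_not_integrable hint]
    contrapose! hint
    exact (lintegral_ofReal_ne_top_iff_integrable (stronglyMeasurable_llr μ ν).aestronglyMeasurable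
      hnonneg).1 hint.symm

section Diagonal

variable [Countable S] [MeasurableSingletonClass S] (P : Measure S) [IsProbabilityMeasure P]

lemma map_diag_eq_withDensity : P.map (fun s => (s, s)) =
    (P.prod P).withDensity ((Set.diagonal S).indicator fun p => (P {p.1})⁻¹) := by
  refine Measure.ext_of_singleton fun ⟨s, t⟩ => ?_
  have hprod : P.prod P {(s, t)} = P {s} * P {t} := by
    rw [← Set.singleton_prod_singleton, Measure.prod_prod]
  rw [Measure.map_apply .of_discrete (by simp), withDensity_apply _ (by simp),
    lintegral_singleton, hprod]
  by_cases hst : s = t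
  · subst hst
    have hpre : (fun s : S => (s, s)) ⁻¹' {(s, s)} = {s} := by ext; simp
    rw [hpre, Set.indicator_of_mem (by simp)]
    rcases eq_or_ne (P {s}) 0 with h0 | h0
    · simp [h0]
    · rw [← mul_assoc, ENNReal.inv_mul_cancel h0 (measure_ne_top _ _), one_mul]
  · have hpre : (fun s : S => (s, s)) ⁻¹' {(s, t)} = ∅ := by
      ext r
      simp only [Set.mem_preimage, Set.mem_singleton_iff, Prod.mk.injEq, Set.mem_empty_iff_false,
        iff_false]
      rintro ⟨rfl, rfl⟩
      exact hst rfl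
    rw [hpre, Set.indicator_of_notMem (by simpa using hst), measure_empty, zero_mul]

lemma llr_map_diag : llr (P.map fun s => (s, s)) (P.prod P) =ᵐ[P.map fun s => (s, s)]
    fun p => -Real.log (P.real {p.1}) := by
  have hac : P.map (fun s => (s, s)) ≪ P.prod P :=
    map_diag_eq_withDensity P ▸ withDensity_absolutelyContinuous _ _
  have hrn := (P.prod P).rnDeriv_withDensity
    (f := (Set.diagonal S).indicator fun p => (P {p.1})⁻¹) .of_discrete
  rw [← map_diag_eq_withDensity P] at hrn
  have hdiag : ∀ᵐ p ∂P.map (fun s => (s, s)), p ∈ Set.diagonal S :=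
    (ae_map_iff Measurable.of_discrete.aemeasurable .of_discrete).2 (by simp)
  filter_upwards [hac.ae_le hrn, hdiag] with p hp hmem
  rw [llr, hp, Set.indicator_of_mem hmem, ENNReal.toReal_inv, Real.log_inv, measureReal_def]

lemma klDiv_map_diag :
    klDiv (P.map fun s => (s, s)) (P.prod P) = entropyOfLaw P := by
  have : IsProbabilityMeasure (P.map fun s => (s, s)) :=
    Measure.isProbabilityMeasure_map Measurable.of_discrete.aemeasurable
  have hnonneg (p : S × S) : 0 ≤ -Real.log (P.real {p.1}) :=
    neg_nonneg.2 (Real.log_nonpos measureReal_nonneg measureReal_le_one)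
  rw [klDiv_eq_lintegral_of_llr_nonneg
      (map_diag_eq_withDensity P ▸ withDensity_absolutelyContinuous _ _)
      ((llr_map_diag P).mono fun p hp => hp ▸ hnonneg p),
    lintegral_congr_ae ((llr_map_diag P).mono fun p hp => congrArg ENNReal.ofReal hp),
    lintegral_map .of_discrete .of_discrete, lintegral_countable', entropyOfLaw]
  refine tsum_congr fun s => ?_
  rw [Real.negMulLog, neg_mul, ← mul_neg, ENNReal.ofReal_mul measureReal_nonneg,
    ofReal_measureReal, mul_comm]

end Diagonal

-- Data processing: the pair `(f, g)` maps the joint law to the diagonal law of `g`.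
lemma entropyOfLaw_le_klDiv_fst_prod_snd [Countable R] [MeasurableSingletonClass R]
    (ρ : Measure (S × T)) [IsProbabilityMeasure ρ] {f : S → R} {g : T → R} (hf : Measurable f)
    (hg : Measurable g) (hfg : ∀ᵐ p ∂ρ, f p.1 = g p.2) :
    entropyOfLaw (ρ.snd.map g) ≤ klDiv ρ (ρ.fst.prod ρ.snd) := by
  have := Measure.isProbabilityMeasure_map (μ := ρ.snd) hg.aemeasurable
  have hfst : ρ.fst.map f = ρ.snd.map g := by
    rw [Measure.fst, Measure.snd, Measure.map_map hf measurable_fst,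
      Measure.map_map hg measurable_snd]
    exact Measure.map_congr hfg
  have hdiag : ρ.map (Prod.map f g) = (ρ.snd.map g).map fun r => (r, r) := by
    rw [Measure.snd, Measure.map_map hg measurable_snd,
      Measure.map_map .of_discrete (hg.comp measurable_snd)]
    exact Measure.map_congr (hfg.mono fun p hp => Prod.ext hp rfl)
  calc entropyOfLaw (ρ.snd.map g)
      = klDiv ((ρ.snd.map g).map fun r => (r, r)) ((ρ.snd.map g).prod (ρ.snd.map g)) :=
        (klDiv_map_diag _).symm
    _ = klDiv (ρ.map (Prod.map f g)) ((ρ.fst.prod ρ.snd).map (Prod.map f g)) := by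
        rw [hdiag, ← Measure.map_prod_map _ _ hf hg, hfst]
    _ ≤ klDiv ρ (ρ.fst.prod ρ.snd) := klDiv_map_le _ _ (hf.prodMap hg)

end Entropy

/-! ### Conditional distributions -/

section CondDistrib

variable {Ω U V T Z : Type*} [MeasurableSpace Ω] [MeasurableSpace U] [MeasurableSpace V]
  [MeasurableSpace T] [MeasurableSpace Z] {μ : Measure Ω} [IsFiniteMeasure μ]

lemma restrict_map_compProd_condDistrib [StandardBorelSpace T] [Nonempty T] {F : Ω → U} {W : Ω → T}
    (hF : Measurable F) (hW : Measurable W) {N : Set U} (hN : MeasurableSet N) :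
    (μ.map F).restrict N ⊗ₘ condDistrib W F μ =
      (μ.restrict (F ⁻¹' N)).map fun ω => (F ω, W ω) := by
  have hpre : (fun ω => (F ω, W ω)) ⁻¹' (N ×ˢ Set.univ) = F ⁻¹' N := by ext; simp
  rw [← hpre, ← Measure.restrict_map (hF.prodMk hW) (hN.prod .univ),
    ← compProd_map_condDistrib hW.aemeasurable]
  ext s hs
  rw [Measure.compProd_apply hs, Measure.restrict_apply hs,
    Measure.compProd_apply (hs.inter (hN.prod .univ)), ← lintegral_indicator hN]
  refine lintegral_congr fun u => ?_
  by_cases hu : u ∈ N <;> simp [hu, Set.preimage]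

lemma condDistrib_ae_eq_of_agree [StandardBorelSpace T] [Nonempty T] {F F' : Ω → U}
    {W W' : Ω → T} (hF : Measurable F) (hF' : Measurable F') (hW : Measurable W)
    (hW' : Measurable W') {N : Set U} (hN : MeasurableSet N) (hmem : ∀ᵐ ω ∂μ, F ω ∈ N ↔ F' ω ∈ N)
    (hagree : ∀ᵐ ω ∂μ, F ω ∈ N → F ω = F' ω ∧ W ω = W' ω) :
    ∀ᵐ ω ∂μ, F ω ∈ N → condDistrib W F μ (F ω) = condDistrib W' F' μ (F ω) := by
  have hrestrict : μ.restrict (F ⁻¹' N) = μ.restrict (F' ⁻¹' N) :=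
    Measure.restrict_congr_set (hmem.mono fun ω hω => propext hω)
  have hagree' := (ae_restrict_iff' (hF hN)).2 hagree
  have hlaw : (μ.map F).restrict N = (μ.map F').restrict N := by
    rw [Measure.restrict_map hF hN, Measure.restrict_map hF' hN, ← hrestrict]
    exact Measure.map_congr (hagree'.mono fun ω hω => hω.1)
  have hjoint : (μ.map F).restrict N ⊗ₘ condDistrib W F μ =
      (μ.map F).restrict N ⊗ₘ condDistrib W' F' μ := by
    rw [restrict_map_compProd_condDistrib hF hW hN, hlaw,
      restrict_map_compProd_condDistrib hF' hW' hN, ← hrestrict]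
    exact Measure.map_congr (hagree'.mono fun ω hω => Prod.ext hω.1 hω.2)
  exact ae_of_ae_map hF.aemeasurable ((ae_restrict_iff' hN).1 (Kernel.ae_eq_of_compProd_eq hjoint))

lemma condDistrib_comp_of_indepFun [StandardBorelSpace T] [Nonempty T] {F : Ω → U} {Y : Ω → V}
    (hF : Measurable F) (hY : Measurable Y) (hFY : IndepFun F Y μ) {g : U × V → T}
    (hg : Measurable g) :
    ∀ᵐ u ∂μ.map F,
      condDistrib (fun ω => g (F ω, Y ω)) F μ u = (μ.map Y).map fun v => g (u, v) := by
  set κ : Kernel U T := (Kernel.id ×ₖ Kernel.const U (μ.map Y)).map g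
  have hκ (u : U) : κ u = (μ.map Y).map fun v => g (u, v) := by
    rw [Kernel.map_apply _ hg, Kernel.prod_apply, Kernel.id_apply, Kernel.const_apply,
      Measure.dirac_prod, Measure.map_map hg (by fun_prop)]
    rfl
  have hlaw : μ.map (fun ω => (F ω, g (F ω, Y ω))) = μ.map F ⊗ₘ κ := by
    have hpair := (indepFun_iff_map_prod_eq_prod_map_map hF.aemeasurable hY.aemeasurable).1 hFY
    calc μ.map (fun ω => (F ω, g (F ω, Y ω)))
        = ((μ.map F).prod (μ.map Y)).map fun p => (p.1, g p) := by
          rw [← hpair, Measure.map_map (by fun_prop) (by fun_prop)]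
          rfl
      _ = μ.map F ⊗ₘ κ := by
          refine Measure.ext_of_lintegral _ fun f hf => ?_
          rw [Measure.lintegral_compProd hf, lintegral_map hf (by fun_prop),
            lintegral_prod _ (by fun_prop)]
          refine lintegral_congr fun u => ?_
          rw [hκ]
          exact (lintegral_map (hf.comp measurable_prodMk_left)
            (hg.comp measurable_prodMk_left)).symm
  filter_upwards [condDistrib_ae_eq_of_measure_eq_compProd F (by fun_prop) hlaw] with u hu
  rw [hu, hκ]

lemma condDistrib_prodMk_of_indepFun [StandardBorelSpace V] [Nonempty V] [StandardBorelSpace Z]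
    [Nonempty Z] {F : Ω → U} {X : Ω → Z} {Y : Ω → V} (hF : Measurable F) (hX : Measurable X)
    (hY : Measurable Y) (hFXY : IndepFun (fun ω => (F ω, X ω)) Y μ) :
    ∀ᵐ u ∂μ.map F,
      condDistrib (fun ω => (X ω, Y ω)) F μ u = (condDistrib X F μ u).prod (μ.map Y) := by
  have hlaw : μ.map (fun ω => (F ω, X ω, Y ω)) =
      μ.map F ⊗ₘ (condDistrib X F μ ×ₖ Kernel.const U (μ.map Y)) := by
    have hpair := (indepFun_iff_map_prod_eq_prod_map_map (hF.prodMk hX).aemeasurable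
      hY.aemeasurable).1 hFXY
    calc μ.map (fun ω => (F ω, X ω, Y ω))
        = ((μ.map F ⊗ₘ condDistrib X F μ).prod (μ.map Y)).map MeasurableEquiv.prodAssoc := by
          rw [compProd_map_condDistrib hX.aemeasurable, ← hpair,
            Measure.map_map (by fun_prop) (by fun_prop)]
          rfl
      _ = μ.map F ⊗ₘ (condDistrib X F μ ×ₖ Kernel.const U (μ.map Y)) := by
          rw [← Measure.compProd_const, Measure.compProd_assoc']
          congr 1
          ext1 u
          rw [Kernel.compProd_apply_eq_compProd_sectR, Kernel.prod_apply, Kernel.const_apply]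
          exact Measure.compProd_const
  filter_upwards [condDistrib_ae_eq_of_measure_eq_compProd F (by fun_prop) hlaw] with u hu
  rw [hu, Kernel.prod_apply, Kernel.const_apply]

lemma condMutualInfoOfLaw_map_prodMk [StandardBorelSpace U] [Nonempty U] [StandardBorelSpace T]
    [Nonempty T] (Q : Measure Z) [IsProbabilityMeasure Q] (ν : Measure V) [IsProbabilityMeasure ν]
    {g : Z × V → U × T} (hg : Measurable g) :
    condMutualInfoOfLaw ((Q.prod ν).map fun p => (p.1, g p)) =
      ∫⁻ z, klDiv (ν.map fun v => g (z, v))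
        ((ν.map fun v => g (z, v)).fst.prod (ν.map fun v => g (z, v)).snd) ∂Q := by
  have hfst : ((Q.prod ν).map fun p => (p.1, g p)).fst = Q := by
    rw [Measure.fst_map_prodMk hg, ← Measure.fst, Measure.fst_prod]
  have hkernel := condDistrib_comp_of_indepFun (μ := Q.prod ν) measurable_fst measurable_snd
    (indepFun_prod measurable_id measurable_id) hg
  rw [← Measure.fst, ← Measure.snd, Measure.fst_prod, Measure.snd_prod] at hkernel
  rw [condMutualInfoOfLaw, hfst]
  refine lintegral_congr_ae (hkernel.mono fun z hz => ?_)
  simp only [condDistrib_def] at hz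
  simp only [hz]

end CondDistrib

section PosteriorSample

variable {Ω U T : Type*} [MeasurableSpace Ω] [MeasurableSpace U] [MeasurableSpace T]
  [StandardBorelSpace T] [Nonempty T] {μ : Measure Ω} [IsFiniteMeasure μ]

lemma ae_prodMk_of_condDistrib_ae_eq {F : Ω → U} {W W' : Ω → T} (hF : Measurable F)
    (hW : Measurable W) (hW' : Measurable W')
    (h : condDistrib W F μ =ᵐ[μ.map F] condDistrib W' F μ) {p : U × T → Prop}
    (hp : MeasurableSet {q | p q}) (hae : ∀ᵐ ω ∂μ, p (F ω, W' ω)) : ∀ᵐ ω ∂μ, p (F ω, W ω) := by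
  have hlaw : μ.map (fun ω => (F ω, W ω)) = μ.map fun ω => (F ω, W' ω) := by
    rw [← compProd_map_condDistrib hW.aemeasurable, ← compProd_map_condDistrib hW'.aemeasurable]
    exact Measure.compProd_congr h
  rwa [← ae_map_iff (p := p) (hF.prodMk hW').aemeasurable hp, ← hlaw,
    ae_map_iff (hF.prodMk hW).aemeasurable hp] at hae

end PosteriorSample

lemma indepFun_prodMk_comp {Ω Z S T U : Type*} [MeasurableSpace Ω] [MeasurableSpace Z]
    [MeasurableSpace S] [MeasurableSpace T] [MeasurableSpace U] {μ : Measure Ω} [IsFiniteMeasure μ]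
    {ζ : Ω → Z} {X : Ω → S} (hζ : Measurable ζ) (hX : Measurable X) (hζX : IndepFun ζ X μ)
    {f : S → T} {g : S → U} (hf : Measurable f) (hg : Measurable g)
    (hfg : IndepFun f g (μ.map X)) :
    IndepFun (fun ω => (ζ ω, f (X ω))) (fun ω => g (X ω)) μ := by
  have hpair := (indepFun_iff_map_prod_eq_prod_map_map hf.aemeasurable hg.aemeasurable).1 hfg
  have hleft := (indepFun_iff_map_prod_eq_prod_map_map hζ.aemeasurable
    (hf.comp hX).aemeasurable).1 (hζX.comp measurable_id hf)
  have htriple := (indepFun_iff_map_prod_eq_prod_map_map hζ.aemeasurable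
    ((hf.comp hX).prodMk (hg.comp hX)).aemeasurable).1
    (hζX.comp measurable_id (hf.prodMk hg))
  refine (indepFun_iff_map_prod_eq_prod_map_map (hζ.prodMk (hf.comp hX)).aemeasurable
    (hg.comp hX).aemeasurable).2 (MeasurableEquiv.prodAssoc.map_measurableEquiv_injective ?_)
  rw [Measure.map_map (MeasurableEquiv.measurable _)
    ((hζ.prodMk (hf.comp hX)).prodMk (hg.comp hX))]
  refine htriple.trans ?_
  rw [hleft, Measure.prodAssoc_prod, ← Measure.map_map hf hX, ← Measure.map_map hg hX, ← hpair,
    Measure.map_map (hf.prodMk hg) hX]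
  rfl

/-! ### Entry times of sequences of independent random variables -/

section EntryTime

variable {E : Type*}

/-- The first time at which the sequence `x` visits `S`, the duration of a search for an element of
`S` along `x`; it is `0` if `S` is never visited. -/
def entryTime (S : Set E) (x : ℕ → E) : ℕ := sInf {n | x n ∈ S}

variable {S : Set E} {x : ℕ → E}

lemma apply_entryTime_mem (h : ∃ n, x n ∈ S) : x (entryTime S x) ∈ S :=
  Nat.sInf_mem (s := {n | x n ∈ S}) h

lemma notMem_of_lt_entryTime {k : ℕ} (h : k < entryTime S x) : x k ∉ S :=
  Nat.notMem_of_lt_sInf h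

lemma le_entryTime_iff (h : ∃ n, x n ∈ S) {n : ℕ} : n ≤ entryTime S x ↔ ∀ k < n, x k ∉ S := by
  refine ⟨fun hn k hk => notMem_of_lt_entryTime (hk.trans_le hn), fun hn => ?_⟩
  exact not_lt.1 fun hlt => hn _ hlt (apply_entryTime_mem h)

lemma entryTime_eq_iff (h : ∃ n, x n ∈ S) {n : ℕ} :
    entryTime S x = n ↔ (∀ k < n, x k ∉ S) ∧ x n ∈ S := by
  refine ⟨?_, fun ⟨hlt, hn⟩ => le_antisymm (Nat.sInf_le hn) ((le_entryTime_iff h).2 hlt)⟩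
  rintro rfl
  exact ⟨fun k => notMem_of_lt_entryTime, apply_entryTime_mem h⟩

lemma add_entryTime_shift (h : ∃ n, x n ∈ S) {t : ℕ} (ht : t ≤ entryTime S x) :
    t + entryTime S (fun j => x (t + j)) = entryTime S x := by
  have hshift : ∃ j, x (t + j) ∈ S :=
    ⟨entryTime S x - t, by rw [Nat.add_sub_cancel' ht]; exact apply_entryTime_mem h⟩
  refine ((entryTime_eq_iff h).2
    ⟨fun k hk => ?_, apply_entryTime_mem (x := fun j => x (t + j)) hshift⟩).symm
  rcases lt_or_ge k t with hkt | htk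
  · exact (le_entryTime_iff h).1 ht k hkt
  · have := notMem_of_lt_entryTime (x := fun j => x (t + j)) (S := S) (k := k - t) (by omega)
    rwa [Nat.add_sub_cancel' htk] at this

variable [MeasurableSpace E]

open scoped Classical in
lemma measurable_entryTime (hS : MeasurableSet S) : Measurable (entryTime S) := by
  let p (x : ℕ → E) (n : ℕ) : Prop := x n ∈ S ∨ ∀ k, x k ∉ S
  have hp (x : ℕ → E) : ∃ n, p x n := by
    by_cases h : ∃ n, x n ∈ S
    · exact h.imp fun n hn => Or.inl hn
    · exact ⟨0, Or.inr (not_exists.1 h)⟩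
  have hfind : entryTime S = fun x => Nat.find (hp x) := by
    funext x
    by_cases h : ∃ n, x n ∈ S
    · refine (entryTime_eq_iff h).2 ⟨fun k hk hmem => Nat.find_min (hp x) hk (Or.inl hmem), ?_⟩
      exact (Nat.find_spec (hp x)).resolve_right (not_forall_not.2 h)
    · have hempty : {n | x n ∈ S} = ∅ := Set.eq_empty_of_forall_notMem (not_exists.1 h)
      rw [entryTime, hempty, Nat.sInf_empty]
      exact ((Nat.find_eq_zero _).2 (Or.inr (not_exists.1 h))).symm
  have hmem (k : ℕ) : MeasurableSet {x : ℕ → E | x k ∈ S} := measurable_pi_apply k hS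
  have hnever : MeasurableSet {x : ℕ → E | ∀ k, x k ∉ S} := by
    rw [Set.ofPred_forall]
    exact .iInter fun k => (hmem k).compl
  rw [hfind]
  exact measurable_find hp fun n => (hmem n).union hnever

/-- The law of a sequence of independent random variables with common law `P`. -/
def iidLaw (P : Measure E) : Measure (ℕ → E) := Measure.infinitePi fun _ => P

variable {P : Measure E} [IsProbabilityMeasure P]

instance : IsProbabilityMeasure (iidLaw P) := by
  unfold iidLaw
  infer_instance

lemma measurePreserving_eval_iidLaw (k : ℕ) : MeasurePreserving (fun x => x k) (iidLaw P) P :=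
  measurePreserving_eval_infinitePi (fun _ : ℕ => P) k

lemma map_comp_iidLaw {f : ℕ → ℕ} (hf : Function.Injective f) :
    (iidLaw P).map (fun x k => x (f k)) = iidLaw P :=
  Measure.map_infinitePi_infinitePi_of_inj (P := fun _ : ℕ => P) hf

lemma indepFun_prefix_shift_iidLaw (t : ℕ) :
    IndepFun (fun (x : ℕ → E) (k : Fin t) => x k) (fun x j => x (t + j)) (iidLaw P) := by
  have hindep : iIndepFun (fun (i : ℕ) (x : ℕ → E) => x i) (iidLaw P) :=
    iIndepFun_infinitePi (P := fun _ : ℕ => P) (X := fun _ x => x) fun _ => measurable_id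
  have hdisj : Disjoint (Set.Iio t) (Set.Ici t) :=
    Set.disjoint_left.2 fun i hi hj => not_le.2 (Set.mem_Iio.1 hi) hj
  have hblocks := indep_iSup_of_disjoint (fun i => (measurable_pi_apply i).comap_le) hindep hdisj
  rw [IndepFun_iff_Indep]
  refine indep_of_indep_of_le_left (indep_of_indep_of_le_right hblocks ?_) ?_
  · simp_rw [MeasurableSpace.pi, MeasurableSpace.comap_iSup, MeasurableSpace.comap_comp]
    exact iSup_le fun j => le_iSup₂_of_le (t + j) (by simp) le_rfl
  · simp_rw [MeasurableSpace.pi, MeasurableSpace.comap_iSup, MeasurableSpace.comap_comp]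
    exact iSup_le fun j => le_iSup₂_of_le (j : ℕ) (by simp) le_rfl

lemma map_eval_restrict_iidLaw (hS : MeasurableSet S) (n : ℕ) :
    ((iidLaw P).restrict {x | ∀ k < n, x k ∉ S}).map (fun x => x n) = P Sᶜ ^ n • P := by
  refine Measure.ext fun B hB => ?_
  have hbox : (fun x : ℕ → E => x n) ⁻¹' B ∩ {x | ∀ k < n, x k ∉ S} =
      Set.pi (Finset.range (n + 1)) fun k => if k = n then B else Sᶜ := by
    ext x
    simp only [Set.mem_inter_iff, Set.mem_preimage, Set.mem_ofPred_eq, Set.mem_pi,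
      Finset.coe_range, Set.mem_Iio]
    refine ⟨fun ⟨hB, hS⟩ k hk => ?_, fun h => ⟨by simpa using h n n.lt_succ_self, fun k hk => ?_⟩⟩
    · split_ifs with hkn
      · exact hkn ▸ hB
      · exact hS k (by omega)
    · simpa [hk.ne] using h k (hk.trans n.lt_succ_self)
  rw [Measure.map_apply (measurable_pi_apply n) hB,
    Measure.restrict_apply (measurable_pi_apply n hB), hbox, iidLaw, Measure.infinitePi_pi,
    Finset.prod_range_succ, Measure.smul_apply, smul_eq_mul, if_pos rfl]
  · congr 1
    rw [Finset.prod_congr rfl (g := fun _ => P Sᶜ), Finset.prod_const, Finset.card_range]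
    exact fun k hk => by rw [if_neg (Finset.mem_range.1 hk).ne]
  · intro k _
    split_ifs
    exacts [hB, hS.compl]

lemma iidLaw_forall_lt_notMem (hS : MeasurableSet S) (n : ℕ) :
    iidLaw P {x | ∀ k < n, x k ∉ S} = P Sᶜ ^ n := by
  have h := congrArg (· Set.univ) (map_eval_restrict_iidLaw (P := P) hS n)
  simpa [Measure.map_apply (measurable_pi_apply n)] using h

lemma setIntegral_eval_iidLaw (hS : MeasurableSet S) {f : E → ℝ} (hf : Measurable f) (n : ℕ) :
    ∫ x in {x | ∀ k < n, x k ∉ S}, f (x n) ∂iidLaw P = P.real Sᶜ ^ n * ∫ y, f y ∂P := by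
  rw [← integral_map (φ := fun x : ℕ → E => x n) (measurable_pi_apply n).aemeasurable
      hf.aestronglyMeasurable, map_eval_restrict_iidLaw hS, integral_smul_measure,
    ENNReal.toReal_pow, smul_eq_mul, measureReal_def]

lemma ae_exists_mem_iidLaw (hS : MeasurableSet S) (h0 : P S ≠ 0) :
    ∀ᵐ x ∂iidLaw P, ∃ n, x n ∈ S := by
  have hlt : P Sᶜ < 1 := by
    rw [prob_compl_eq_one_sub hS]
    exact ENNReal.sub_lt_self ENNReal.one_ne_top one_ne_zero h0
  rw [ae_iff, ← nonpos_iff_eq_zero]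
  refine ge_of_tendsto' (ENNReal.tendsto_pow_atTop_nhds_zero_of_lt_one hlt) fun n => ?_
  rw [← iidLaw_forall_lt_notMem hS]
  exact measure_mono fun x hx k _ hk => hx ⟨k, hk⟩

lemma map_entryTime_iidLaw (hS : MeasurableSet S) {p : unitInterval} (hp : p ≠ 0)
    (hPS : P S = ENNReal.ofReal p) : (iidLaw P).map (entryTime S) = geometricMeasure p := by
  have hpos : (0 : ℝ) < p := unitInterval.pos_iff_ne_zero.2 hp
  have hcompl : P Sᶜ = ENNReal.ofReal (1 - p) := by
    rw [prob_compl_eq_one_sub hS, hPS, ← ENNReal.ofReal_one, ENNReal.ofReal_sub _ p.2.1]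
  refine Measure.ext_of_singleton fun n => ?_
  have hevent : entryTime S ⁻¹' {n} =ᵐ[iidLaw P]
      ((fun x => x n) ⁻¹' S ∩ {x | ∀ k < n, x k ∉ S} : Set (ℕ → E)) := by
    filter_upwards [ae_exists_mem_iidLaw hS (by simpa [hPS] using hpos)] with x hx
    exact propext ((entryTime_eq_iff hx).trans and_comm)
  have hmap : iidLaw P ((fun x => x n) ⁻¹' S ∩ {x | ∀ k < n, x k ∉ S}) = P Sᶜ ^ n * P S := by
    rw [← Measure.restrict_apply (measurable_pi_apply n hS),
      ← Measure.map_apply (measurable_pi_apply n) hS, map_eval_restrict_iidLaw hS,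
      Measure.smul_apply, smul_eq_mul]
  rw [Measure.map_apply (measurable_entryTime hS) (measurableSet_singleton n),
    measure_congr hevent, hmap, geometricMeasure_singleton hp, hcompl, hPS,
    ENNReal.ofReal_mul (pow_nonneg (sub_nonneg.2 p.2.2) n),
    ENNReal.ofReal_pow (sub_nonneg.2 p.2.2)]

end EntryTime

section FollowUntilEntry

variable {E : Type*} {S : Set E} {x : ℕ → E}

lemma entryTime_apply_min_entryTime (h : ∃ n, x n ∈ S) :
    entryTime S (fun t => x (min t (entryTime S x))) = entryTime S x := by
  have hmem := apply_entryTime_mem h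
  refine (entryTime_eq_iff ⟨entryTime S x, by rwa [min_self]⟩).2 ⟨fun k hk => ?_, by rwa [min_self]⟩
  rw [min_eq_left hk.le]
  exact notMem_of_lt_entryTime hk

lemma eq_apply_min_entryTime {y : ℕ → E} (h : ∃ n, x n ∈ S)
    (hold : ∀ t, ∀ k < t, y k ∈ S → (∀ j < k, y j ∉ S) → y t = y k)
    (hnew : ∀ t, (∀ k < t, y k ∉ S) → (∀ k < t, y k = x k) → y t = x t) (t : ℕ) :
    y t = x (min t (entryTime S x)) := by
  have hfollow : ∀ t ≤ entryTime S x, ∀ k ≤ t, y k = x k := by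
    intro t ht k hk
    induction k using Nat.strong_induction_on with
    | _ k ih =>
      have hagree : ∀ j < k, y j = x j := fun j hj => ih j hj (hj.le.trans hk)
      refine hnew k (fun j hj => ?_) hagree
      rw [hagree j hj]
      exact notMem_of_lt_entryTime (hj.trans_le (hk.trans ht))
  rcases le_or_gt t (entryTime S x) with ht | ht
  · rw [min_eq_left ht, hfollow t ht t le_rfl]
  · have hentry := hfollow _ le_rfl
    rw [min_eq_right ht.le, ← hentry _ le_rfl]
    refine hold t _ ht ?_ fun j hj => ?_
    · rw [hentry _ le_rfl]
      exact apply_entryTime_mem h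
    · rw [hentry j hj.le]
      exact notMem_of_lt_entryTime hj

end FollowUntilEntry

section Measurability

variable {Ω β : Type*} [MeasurableSpace Ω] [MeasurableSpace β]

lemma measurable_apply_nat {f : Ω → ℕ → β} (hf : ∀ a, Measurable fun ω => f ω a) {N : Ω → ℕ}
    (hN : Measurable N) : Measurable fun ω => f ω (N ω) :=
  (measurable_from_prod_countable_right (f := fun p : ℕ × Ω => f p.2 p.1) hf).comp
    (hN.prodMk measurable_id)

end Measurability

/-! ### Sequential search among independent uniform rewards -/

section UniformRewards

/-- The uniform distribution on `[0, 1]`, the law of a single reward. -/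
def unitUniform : Measure ℝ := ProbabilityTheory.cond volume (Set.Icc 0 1)

lemma unitUniform_eq_restrict : unitUniform = volume.restrict (Set.Icc 0 1) := by
  simp [unitUniform, ProbabilityTheory.cond]

instance : IsProbabilityMeasure unitUniform := by
  rw [unitUniform_eq_restrict]
  exact ⟨by simp⟩

lemma ae_mem_Icc_unitUniform : ∀ᵐ y ∂unitUniform, y ∈ Set.Icc (0 : ℝ) 1 := by
  rw [unitUniform_eq_restrict]
  exact ae_restrict_mem measurableSet_Icc

lemma unitUniform_Ici {s : ℝ} (hs : 0 ≤ s) :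
    unitUniform (Set.Ici s) = ENNReal.ofReal (1 - s) := by
  have hinter : Set.Ici s ∩ Set.Icc 0 1 = Set.Icc s 1 := by
    ext y
    exact ⟨fun h => ⟨h.1, h.2.2⟩, fun h => ⟨h.1, hs.trans h.1, h.2⟩⟩
  rw [unitUniform_eq_restrict, Measure.restrict_apply measurableSet_Ici, hinter, Real.volume_Icc]

lemma unitUniform_real_compl_Ici {s : ℝ} (h0 : 0 ≤ s) (h1 : s ≤ 1) :
    unitUniform.real (Set.Ici s)ᶜ = s := by
  rw [probReal_compl_eq_one_sub measurableSet_Ici, measureReal_def, unitUniform_Ici h0,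
    ENNReal.toReal_ofReal (sub_nonneg.2 h1), sub_sub_cancel]

lemma integral_one_sub_unitUniform : ∫ y, (1 - y) ∂unitUniform = 1 / 2 := by
  rw [unitUniform_eq_restrict, integral_Icc_eq_integral_Ioc,
    ← intervalIntegral.integral_of_le zero_le_one]
  rw [intervalIntegral.integral_sub intervalIntegrable_const intervalIntegral.intervalIntegrable_id,
    intervalIntegral.integral_const, integral_id]
  norm_num

/-- The law of a sequence of independent rewards, each uniform on `[0, 1]`. -/
abbrev rewardLaw : Measure (ℕ → ℝ) := iidLaw unitUniform

lemma ae_mem_Icc_rewardLaw : ∀ᵐ x ∂rewardLaw, ∀ n, x n ∈ Set.Icc (0 : ℝ) 1 :=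
  ae_all_iff.2 fun n =>
    (measurePreserving_eval_iidLaw n).quasiMeasurePreserving.ae ae_mem_Icc_unitUniform

lemma ae_exists_mem_Ici_rewardLaw {s : ℝ} (h0 : 0 ≤ s) (h1 : s < 1) :
    ∀ᵐ x ∂rewardLaw, ∃ n, x n ∈ Set.Ici s :=
  ae_exists_mem_iidLaw measurableSet_Ici (by simpa [unitUniform_Ici h0] using h1)

lemma ae_iSup_eq_one_rewardLaw : ∀ᵐ x ∂rewardLaw, ⨆ n, x n = 1 := by
  have hnear : ∀ᵐ x ∂rewardLaw, ∀ m : ℕ, ∃ n, x n ∈ Set.Ici (1 - 1 / ((m : ℝ) + 1)) :=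
    ae_all_iff.2 fun m => ae_exists_mem_Ici_rewardLaw
      (sub_nonneg.2 ((div_le_one (by positivity)).2 (by simp))) (sub_lt_self _ (by positivity))
  filter_upwards [hnear, ae_mem_Icc_rewardLaw] with x hx hmem
  have hbdd : BddAbove (Set.range x) := ⟨1, Set.forall_mem_range.2 fun n => (hmem n).2⟩
  refine le_antisymm (ciSup_le fun n => (hmem n).2) (le_of_forall_pos_sub_le fun δ hδ => ?_)
  obtain ⟨m, hm⟩ := exists_nat_one_div_lt hδ
  obtain ⟨n, hn⟩ := hx m
  exact (sub_le_sub_left hm.le 1).trans (hn.trans (le_ciSup hbdd n))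

/-- The gain in reward from continuing the search for an element of `S` along the rewards `x`
until it succeeds, rather than settling for the first reward. -/
def searchGain (S : Set ℝ) (x : ℕ → ℝ) : ℝ := x (entryTime S x) - x 0

variable {S : Set ℝ}

lemma searchGain_nonneg {x : ℕ → ℝ} (hS : IsUpperSet S) (h : ∃ n, x n ∈ S) :
    0 ≤ searchGain S x := by
  by_contra! hneg
  have hlt : x (entryTime S x) < x 0 := sub_neg.1 hneg
  have hzero : entryTime S x = 0 :=
    (entryTime_eq_iff h).2 ⟨by simp, hS hlt.le (apply_entryTime_mem h)⟩
  exact hlt.ne (congrArg x hzero)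

lemma measurable_searchGain (hS : MeasurableSet S) : Measurable (searchGain S) :=
  (measurable_apply_nat measurable_pi_apply (measurable_entryTime hS)).sub (measurable_pi_apply 0)

variable {s : ℝ}

lemma ae_searchGain_mem_Icc (h0 : 0 ≤ s) (h1 : s < 1) :
    ∀ᵐ x ∂rewardLaw, searchGain (Set.Ici s) x ∈ Set.Icc 0 (1 - x 0) := by
  filter_upwards [ae_exists_mem_Ici_rewardLaw h0 h1, ae_mem_Icc_rewardLaw] with x hx hmem
  exact ⟨searchGain_nonneg (isUpperSet_Ici s) hx, sub_le_sub_right (hmem _).2 _⟩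

lemma integrable_one_sub_eval_rewardLaw (n : ℕ) : Integrable (fun x => 1 - x n) rewardLaw := by
  refine Integrable.of_mem_Icc 0 1 (measurable_pi_apply n |>.const_sub 1).aemeasurable ?_
  filter_upwards [ae_mem_Icc_rewardLaw] with x hx
  exact ⟨sub_nonneg.2 (hx n).2, sub_le_self _ (hx n).1⟩

lemma integrable_searchGain (h0 : 0 ≤ s) (h1 : s < 1) :
    Integrable (searchGain (Set.Ici s)) rewardLaw := by
  refine (integrable_one_sub_eval_rewardLaw 0).mono'
    (measurable_searchGain measurableSet_Ici).aestronglyMeasurable ?_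
  filter_upwards [ae_searchGain_mem_Icc h0 h1] with x hx
  exact (Real.norm_of_nonneg hx.1).trans_le hx.2

lemma integral_searchGain_mem_Icc (h0 : 0 ≤ s) (h1 : s < 1) :
    ∫ x, searchGain (Set.Ici s) x ∂rewardLaw ∈ Set.Icc 0 (1 / 2 : ℝ) := by
  have hgain := ae_searchGain_mem_Icc h0 h1
  refine ⟨integral_nonneg_of_ae (hgain.mono fun x hx => hx.1), ?_⟩
  calc ∫ x, searchGain (Set.Ici s) x ∂rewardLaw
      ≤ ∫ x : ℕ → ℝ, (1 - x 0) ∂rewardLaw :=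
        integral_mono_ae (integrable_searchGain h0 h1) (integrable_one_sub_eval_rewardLaw 0)
          (hgain.mono fun x hx => hx.2)
    _ = 1 / 2 := by
        rw [← integral_one_sub_unitUniform,
          ← (measurePreserving_eval_iidLaw (P := unitUniform) 0).map_eq,
          integral_map (measurable_pi_apply 0).aemeasurable (by fun_prop)]

lemma one_sub_apply_min_entryTime_le {x : ℕ → ℝ} (h : ∃ n, x n ∈ Set.Ici s) (hx : ∀ n, x n ≤ 1)
    (hs : s ≤ 1) (t : ℕ) :
    1 - x (min t (entryTime (Set.Ici s) x)) ≤
      1 - s + {x : ℕ → ℝ | ∀ k < t, x k ∉ Set.Ici s}.indicator (fun x => 1 - x t) x := by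
  rcases le_or_gt t (entryTime (Set.Ici s) x) with ht | ht
  · have hmem : x ∈ {x : ℕ → ℝ | ∀ k < t, x k ∉ Set.Ici s} := (le_entryTime_iff h).1 ht
    rw [min_eq_left ht, Set.indicator_of_mem hmem]
    exact le_add_of_nonneg_left (sub_nonneg.2 hs)
  · rw [min_eq_right ht.le]
    exact le_add_of_le_of_nonneg (sub_le_sub_left (apply_entryTime_mem h) 1)
      (Set.indicator_apply_nonneg fun _ => sub_nonneg.2 (hx t))

lemma measurable_apply_min_entryTime (t : ℕ) :
    Measurable fun x : ℕ → ℝ => x (min t (entryTime (Set.Ici s) x)) :=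
  measurable_apply_nat measurable_pi_apply
    (measurable_const.min (measurable_entryTime measurableSet_Ici))

lemma integral_one_sub_apply_min_entryTime_le (h0 : 0 ≤ s) (h1 : s < 1) (t : ℕ) :
    ∫ x, (1 - x (min t (entryTime (Set.Ici s) x))) ∂rewardLaw ≤ 1 - s + s ^ t / 2 := by
  set C : Set (ℕ → ℝ) := {x | ∀ k < t, x k ∉ Set.Ici s} with hCdef
  have hC : MeasurableSet C := by
    simp only [hCdef, Set.ofPred_forall]
    exact .iInter fun k => .iInter fun _ => (measurable_pi_apply k measurableSet_Ici).compl
  have hindicator : Integrable (C.indicator fun x => 1 - x t) rewardLaw :=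
    (integrable_one_sub_eval_rewardLaw t).indicator hC
  have hint : Integrable (fun x => 1 - x (min t (entryTime (Set.Ici s) x))) rewardLaw := by
    refine .of_mem_Icc 0 1 ((measurable_apply_min_entryTime t).const_sub 1).aemeasurable ?_
    filter_upwards [ae_mem_Icc_rewardLaw] with x hx
    exact ⟨sub_nonneg.2 (hx _).2, sub_le_self _ (hx _).1⟩
  calc ∫ x, (1 - x (min t (entryTime (Set.Ici s) x))) ∂rewardLaw
      ≤ ∫ x, (1 - s + C.indicator (fun x => 1 - x t) x) ∂rewardLaw := by
        refine integral_mono_ae hint ((integrable_const _).add hindicator) ?_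
        filter_upwards [ae_exists_mem_Ici_rewardLaw h0 h1, ae_mem_Icc_rewardLaw] with x hx hmem
        exact one_sub_apply_min_entryTime_le hx (fun n => (hmem n).2) h1.le t
    _ = 1 - s + ∫ x in C, (1 - x t) ∂rewardLaw := by
        rw [integral_add (integrable_const _) hindicator, integral_indicator hC]
        simp
    _ = 1 - s + s ^ t / 2 := by
        rw [setIntegral_eval_iidLaw measurableSet_Ici (measurable_const_sub 1),
          unitUniform_real_compl_Ici h0 h1.le, integral_one_sub_unitUniform, mul_one_div]

end UniformRewards

/-! ### Satisficing Thompson sampling as a sequential search -/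

section SearchOrder

variable {Ξ : Type*}

/-- The order in which the rule `fresh` designates new actions when the internal randomness is `z`:
the actions tried by the agent as long as none of them is satisfactory. -/
def searchOrder (fresh : ∀ t, (Fin t → ℕ) × Ξ → ℕ) (z : Ξ) (t : ℕ) : ℕ :=
  fresh t (fun k : Fin t => searchOrder fresh z k, z)
termination_by t
decreasing_by exact k.2

variable {fresh : ∀ t, (Fin t → ℕ) × Ξ → ℕ}

lemma searchOrder_injective (hfresh : ∀ t past z, ∀ k : Fin t, fresh t (past, z) ≠ past k) (z : Ξ) :
    Function.Injective (searchOrder fresh z) := by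
  refine .of_lt_imp_ne fun i j hij => ?_
  rw [searchOrder.eq_1 fresh z j]
  exact (hfresh j (fun k => searchOrder fresh z k) z ⟨i, hij⟩).symm

lemma measurable_searchOrder [MeasurableSpace Ξ] (hfresh : ∀ t, Measurable (fresh t)) (k : ℕ) :
    Measurable fun z => searchOrder fresh z k := by
  induction k using Nat.strong_induction_on with
  | _ k ih =>
    simp_rw [fun z => searchOrder.eq_1 fresh z k]
    exact (hfresh k).comp ((measurable_pi_iff.2 fun j : Fin k => ih j j.2).prodMk measurable_id)

end SearchOrder

section SequentialSearch

variable {Ω Ξ : Type*} [MeasurableSpace Ω] [MeasurableSpace Ξ]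
  {μ : Measure Ω} {θ : ℕ → Ω → ℝ} {ξ : Ω → Ξ} {ε : ℝ} {A : ℕ → Ω → ℕ}
  {b : Ξ → ℕ → ℕ}

lemma measurable_history (hθ : ∀ a, Measurable (θ a)) {t : ℕ} (hA : ∀ k < t, Measurable (A k)) :
    Measurable (history θ A t) :=
  measurable_pi_iff.2 fun k =>
    (hA k k.2).prodMk (measurable_apply_nat (f := fun ω a => θ a ω) hθ (hA k k.2))

/-- The rewards of the actions `b ξ 0, b ξ 1, …`, in this order. -/
def orderedReward (θ : ℕ → Ω → ℝ) (ξ : Ω → Ξ) (b : Ξ → ℕ → ℕ) (ω : Ω) (k : ℕ) : ℝ :=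
  θ (b (ξ ω) k) ω

/-- The process `A` searches through the actions `b ξ 0, b ξ 1, …` of a deterministic bandit, in
this order, and plays the first one whose reward is at least `1 - ε` ever after. -/
structure IsSequentialSearch (μ : Measure Ω) (θ : ℕ → Ω → ℝ) (ξ : Ω → Ξ) (ε : ℝ) (A : ℕ → Ω → ℕ)
    (b : Ξ → ℕ → ℕ) : Prop extends IsDeterministicBandit μ θ ξ where
  measurable_action : ∀ t, Measurable (A t)
  measurable_order : ∀ k, Measurable fun z => b z k
  injective_order : ∀ z, Function.Injective (b z)
  action_eq : ∀ᵐ ω ∂μ, ∀ t,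
    A t ω = b (ξ ω) (min t (entryTime (Set.Ici (1 - ε)) (orderedReward θ ξ b ω)))

namespace IsDeterministicBandit

lemma measurable_rewards (hB : IsDeterministicBandit μ θ ξ) : Measurable fun ω a => θ a ω :=
  measurable_pi_iff.2 hB.measurable_reward

lemma map_rewards (hB : IsDeterministicBandit μ θ ξ) : μ.map (fun ω a => θ a ω) = rewardLaw := by
  rw [hB.indep.map_fun_eq_infinitePi_map hB.measurable_reward]
  exact congrArg Measure.infinitePi (funext hB.uniform)

lemma ae_optReward_eq_one (hB : IsDeterministicBandit μ θ ξ) : ∀ᵐ ω ∂μ, optReward θ ω = 1 :=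
  ae_of_ae_map hB.measurable_rewards.aemeasurable (hB.map_rewards ▸ ae_iSup_eq_one_rewardLaw)

lemma ae_reward_mem_Icc (hB : IsDeterministicBandit μ θ ξ) :
    ∀ᵐ ω ∂μ, ∀ a, θ a ω ∈ Set.Icc (0 : ℝ) 1 :=
  ae_of_ae_map hB.measurable_rewards.aemeasurable (hB.map_rewards ▸ ae_mem_Icc_rewardLaw)

lemma measurable_orderedReward (hB : IsDeterministicBandit μ θ ξ)
    (hb : ∀ k, Measurable fun z => b z k) : Measurable (orderedReward θ ξ b) :=
  measurable_pi_iff.2 fun k => measurable_apply_nat (f := fun ω a => θ a ω) hB.measurable_reward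
    ((hb k).comp hB.measurable_exogenous)

variable [IsProbabilityMeasure μ]

lemma map_exogenous_orderedReward (hB : IsDeterministicBandit μ θ ξ)
    (hb : ∀ k, Measurable fun z => b z k) (hinj : ∀ z, Function.Injective (b z)) :
    μ.map (fun ω => (ξ ω, orderedReward θ ξ b ω)) = (μ.map ξ).prod rewardLaw := by
  have hreorder : Measurable (Function.uncurry fun (z : Ξ) (x : ℕ → ℝ) (k : ℕ) => x (b z k)) :=
    measurable_pi_iff.2 fun k => measurable_apply_nat (f := fun p : Ξ × (ℕ → ℝ) => p.2)
      (fun a => (measurable_pi_apply a).comp measurable_snd) ((hb k).comp measurable_fst)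
  have hlaw : μ.map (fun ω => (ξ ω, fun a => θ a ω)) = (μ.map ξ).prod rewardLaw := by
    rw [← hB.map_rewards]
    exact (indepFun_iff_map_prod_eq_prod_map_map hB.measurable_exogenous.aemeasurable
      hB.measurable_rewards.aemeasurable).1 hB.indep_exogenous
  have hskew := ((MeasurePreserving.id (μ.map ξ)).skew_product hreorder
    (.of_forall fun z => map_comp_iidLaw (P := unitUniform) (hinj z))).map_eq
  nth_rewrite 1 [← hskew, ← hlaw]
  exact (Measure.map_map (measurable_fst.prodMk hreorder)
    (hB.measurable_exogenous.prodMk hB.measurable_rewards)).symm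

lemma map_orderedReward (hB : IsDeterministicBandit μ θ ξ)
    (hb : ∀ k, Measurable fun z => b z k) (hinj : ∀ z, Function.Injective (b z)) :
    μ.map (orderedReward θ ξ b) = rewardLaw := by
  have := Measure.isProbabilityMeasure_map (μ := μ) hB.measurable_exogenous.aemeasurable
  rw [← Measure.snd_map_prodMk hB.measurable_exogenous, hB.map_exogenous_orderedReward hb hinj,
    Measure.snd_prod]

lemma indepFun_exogenous_orderedReward (hB : IsDeterministicBandit μ θ ξ)
    (hb : ∀ k, Measurable fun z => b z k) (hinj : ∀ z, Function.Injective (b z)) :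
    IndepFun ξ (orderedReward θ ξ b) μ := by
  rw [indepFun_iff_map_prod_eq_prod_map_map hB.measurable_exogenous.aemeasurable
    (hB.measurable_orderedReward hb).aemeasurable, hB.map_exogenous_orderedReward hb hinj,
    hB.map_orderedReward hb hinj]

end IsDeterministicBandit

section STS

variable {sample : ∀ t, History t × Ξ → ℕ → ℝ} {fresh : ∀ t, (Fin t → ℕ) × Ξ → ℕ} {t : ℕ}

lemma measurableSet_satisfactory {S : Ω → ℕ → ℝ} (hS : Measurable S) {k : ℕ}
    (hA : Measurable (A k)) : MeasurableSet {ω | Satisfactory ε A (S ω) ω k} :=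
  measurableSet_le (.iSup fun a => (measurable_pi_apply a).comp hS)
    ((measurable_apply_nat (fun a => (measurable_pi_apply a).comp hS) hA).add_const ε)

open scoped Classical in
lemma measurable_action_of_past (hA : ∀ k < t, Measurable (A k)) {S : Ω → ℕ → ℝ}
    (hS : Measurable S) {B : Ω → ℕ} (hB : Measurable B)
    (hold : ∀ ω, ∀ k < t, Satisfactory ε A (S ω) ω k →
      (∀ j < k, ¬ Satisfactory ε A (S ω) ω j) → A t ω = A k ω)
    (hnew : ∀ ω, (∀ k < t, ¬ Satisfactory ε A (S ω) ω k) → A t ω = B ω) : Measurable (A t) := by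
  let f (n : ℕ) : Ω → ℕ := if n < t then A n else B
  let p (n : ℕ) (ω : Ω) : Prop := n < t → Satisfactory ε A (S ω) ω n
  have hf (n : ℕ) : Measurable (f n) := by
    by_cases hn : n < t
    · simpa only [f, if_pos hn] using hA n hn
    · simpa only [f, if_neg hn] using hB
  have hp (n : ℕ) : MeasurableSet {ω | p n ω} := by
    by_cases hn : n < t
    · simpa only [p, hn, forall_const] using measurableSet_satisfactory hS (hA n hn)
    · simp [p, hn]
  have hex (ω : Ω) : ∃ n, p n ω := ⟨t, fun h => absurd h (lt_irrefl t)⟩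
  have hfind : A t = fun ω => f (Nat.find (hex ω)) ω := by
    funext ω
    have hmin {j : ℕ} (hj : j < Nat.find (hex ω)) : j < t ∧ ¬ Satisfactory ε A (S ω) ω j :=
      Classical.not_imp.1 (Nat.find_min (hex ω) hj)
    by_cases hn : Nat.find (hex ω) < t
    · simp only [f, if_pos hn]
      exact hold ω _ hn (Nat.find_spec (hex ω) hn) fun j hj => (hmin hj).2
    · simp only [f, if_neg hn]
      exact hnew ω fun k hk => (hmin (hk.trans_le (not_lt.1 hn))).2
  rw [hfind]
  exact Measurable.find hf hp hex

lemma measurable_action_of_rule (hB : IsDeterministicBandit μ θ ξ)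
    (hsample : ∀ t, Measurable (sample t)) (hfresh : ∀ t, Measurable (fresh t))
    (hold : ∀ t ω, ∀ k < t, Satisfactory ε A (sample t (history θ A t ω, ξ ω)) ω k →
      (∀ j < k, ¬ Satisfactory ε A (sample t (history θ A t ω, ξ ω)) ω j) → A t ω = A k ω)
    (hnew : ∀ t ω, (∀ k < t, ¬ Satisfactory ε A (sample t (history θ A t ω, ξ ω)) ω k) →
      A t ω = fresh t (fun k => A k ω, ξ ω)) (t : ℕ) : Measurable (A t) := by
  induction t using Nat.strong_induction_on with
  | _ t ih =>
    have hH := measurable_history hB.measurable_reward ih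
    have hpast : Measurable fun ω (k : Fin t) => A k ω := measurable_pi_iff.2 fun k => ih k k.2
    exact measurable_action_of_past ih
      ((hsample t).comp (hH.prodMk hB.measurable_exogenous))
      ((hfresh t).comp (hpast.prodMk hB.measurable_exogenous)) (hold t) (hnew t)

lemma measurableSet_optimum_eq_one_and_consistent (t : ℕ) :
    MeasurableSet {q : History t × (ℕ → ℝ) | ⨆ a, q.2 a = 1 ∧ ∀ k, q.2 (q.1 k).1 = (q.1 k).2} := by
  have hcoord (a : ℕ) : Measurable fun q : History t × (ℕ → ℝ) => q.2 a :=
    (measurable_pi_apply a).comp measurable_snd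
  have hconsistent : MeasurableSet
      {q : History t × (ℕ → ℝ) | ∀ k, q.2 (q.1 k).1 = (q.1 k).2} := by
    rw [Set.ofPred_forall]
    exact .iInter fun k => measurableSet_eq_fun (measurable_apply_nat hcoord (by fun_prop))
      (by fun_prop)
  exact (measurableSet_eq_fun (.iSup hcoord) measurable_const).inter hconsistent

/-- Jointly with the history, the sample and the true model have the same law, so the sample also
has supremum `1` and agrees with the rewards revealed so far, almost surely. -/
lemma ae_satisfactory_posterior_sample_iff [IsProbabilityMeasure μ]
    (hB : IsDeterministicBandit μ θ ξ) (hA : ∀ k < t, Measurable (A k)) {S : Ω → ℕ → ℝ}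
    (hS : Measurable S) (hpost : condDistrib S (history θ A t) μ =ᵐ[μ.map (history θ A t)]
      condDistrib (fun ω a => θ a ω) (history θ A t) μ) :
    ∀ᵐ ω ∂μ, ∀ k < t, Satisfactory ε A (S ω) ω k ↔ θ (A k ω) ω ∈ Set.Ici (1 - ε) := by
  have htrue : ∀ᵐ ω ∂μ, ⨆ a, θ a ω = 1 ∧ ∀ k : Fin t, θ (A k ω) ω = θ (A k ω) ω :=
    hB.ae_optReward_eq_one.mono fun ω hω => ⟨hω, fun k => rfl⟩
  filter_upwards [ae_prodMk_of_condDistrib_ae_eq (measurable_history hB.measurable_reward hA) hS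
    hB.measurable_rewards hpost (measurableSet_optimum_eq_one_and_consistent t) htrue]
    with ω ⟨hsup, hpast⟩ k hk
  have hconsistent : S ω (A k ω) = θ (A k ω) ω := hpast ⟨k, hk⟩
  rw [Satisfactory, hsup, hconsistent, Set.mem_Ici, sub_le_iff_le_add]

lemma ae_exists_orderedReward_mem [IsProbabilityMeasure μ] (hB : IsDeterministicBandit μ θ ξ)
    (hb : ∀ k, Measurable fun z => b z k) (hinj : ∀ z, Function.Injective (b z))
    (h0 : 0 < ε) (h1 : ε ≤ 1) : ∀ᵐ ω ∂μ, ∃ k, orderedReward θ ξ b ω k ∈ Set.Ici (1 - ε) :=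
  ae_of_ae_map (hB.measurable_orderedReward hb).aemeasurable
    (hB.map_orderedReward hb hinj ▸
      ae_exists_mem_Ici_rewardLaw (sub_nonneg.2 h1) (sub_lt_self 1 h0))

theorem IsSTS.exists_isSequentialSearch [IsProbabilityMeasure μ]
    (hB : IsDeterministicBandit μ θ ξ) (h0 : 0 < ε) (h1 : ε ≤ 1) (hA : IsSTS μ θ ξ ε A) :
    ∃ b : Ξ → ℕ → ℕ, IsSequentialSearch μ θ ξ ε A b := by
  obtain ⟨sample, fresh, hsample, hfresh, hne, hpost, hold, hnew⟩ := hA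
  have hmeas := measurable_action_of_rule hB hsample hfresh hold hnew
  have horder := measurable_searchOrder hfresh
  have hinj := searchOrder_injective hne
  refine ⟨searchOrder fresh, hB, hmeas, horder, hinj, ?_⟩
  have hsat (t : ℕ) := ae_satisfactory_posterior_sample_iff (ε := ε) hB (fun k _ => hmeas k)
    ((hsample t).comp ((measurable_history hB.measurable_reward fun k _ => hmeas k).prodMk
      hB.measurable_exogenous)) (hpost t)
  filter_upwards [ae_exists_orderedReward_mem hB horder hinj h0 h1, ae_all_iff.2 hsat]
    with ω hω hiff t
  refine eq_apply_min_entryTime (S := {a | θ a ω ∈ Set.Ici (1 - ε)}) (y := fun k => A k ω) hω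
    (fun t k hk hgood hbad => ?_) (fun t hbad hagree => ?_) t
  · exact hold t ω k hk ((hiff t k hk).2 hgood) fun j hj =>
      mt (hiff t j (hj.trans hk)).1 (hbad j hj)
  · rw [hnew t ω fun k hk => mt (hiff t k hk).1 (hbad k hk), searchOrder.eq_1]
    congr 2
    exact funext fun k => hagree k k.2

end STS

/-- The history of an agent who tries the first `t` of the actions `b ξ 0, b ξ 1, …`, whatever their
rewards. Unlike `history θ A t`, it is independent of the rewards of the remaining ones. -/
def searchHistory (θ : ℕ → Ω → ℝ) (ξ : Ω → Ξ) (b : Ξ → ℕ → ℕ) (t : ℕ) (ω : Ω) : History t :=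
  fun k => (b (ξ ω) k, orderedReward θ ξ b ω k)

/-- The rewards of the actions `b ξ t, b ξ (t + 1), …`. -/
def remainingReward (θ : ℕ → Ω → ℝ) (ξ : Ω → Ξ) (b : Ξ → ℕ → ℕ) (t : ℕ) (ω : Ω) (j : ℕ) : ℝ :=
  orderedReward θ ξ b ω (t + j)

/-- The histories of length `t` in which no reward is at least `1 - ε`. -/
def unsatisfactoryHistories (ε : ℝ) (t : ℕ) : Set (History t) :=
  {h | ∀ k, (h k).2 ∉ Set.Ici (1 - ε)}

lemma measurableSet_unsatisfactoryHistories (ε : ℝ) (t : ℕ) :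
    MeasurableSet (unsatisfactoryHistories ε t) := by
  rw [unsatisfactoryHistories, Set.ofPred_forall]
  have hreward (k : Fin t) : Measurable fun h : History t => (h k).2 := by fun_prop
  exact .iInter fun k => (hreward k measurableSet_Ici).compl

namespace IsSequentialSearch

lemma measurable_history (h : IsSequentialSearch μ θ ξ ε A b) (t : ℕ) :
    Measurable (history θ A t) :=
  SatisficingBandit.measurable_history h.measurable_reward fun k _ => h.measurable_action k

lemma measurable_reward_action (h : IsSequentialSearch μ θ ξ ε A b) (t : ℕ) :
    Measurable fun ω => θ (A t ω) ω :=
  measurable_apply_nat (f := fun ω a => θ a ω) h.measurable_reward (h.measurable_action t)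

lemma measurable_benchmark (h : IsSequentialSearch μ θ ξ ε A b) : Measurable (benchmark θ A ε) :=
  measurable_apply_nat (f := fun ω t => A t ω) h.measurable_action
    ((measurable_entryTime measurableSet_Ici).comp (measurable_pi_iff.2 h.measurable_reward_action))

lemma measurable_searchHistory (h : IsSequentialSearch μ θ ξ ε A b) (t : ℕ) :
    Measurable (searchHistory θ ξ b t) :=
  measurable_pi_iff.2 fun k => ((h.measurable_order k).comp h.measurable_exogenous).prodMk
    ((measurable_pi_apply (k : ℕ)).comp (h.measurable_orderedReward h.measurable_order))

lemma measurable_remainingReward (h : IsSequentialSearch μ θ ξ ε A b) (t : ℕ) :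
    Measurable (remainingReward θ ξ b t) :=
  measurable_pi_iff.2 fun j =>
    (measurable_pi_apply (t + j)).comp (h.measurable_orderedReward h.measurable_order)

variable [IsProbabilityMeasure μ]

lemma ae_exists_orderedReward_mem (h : IsSequentialSearch μ θ ξ ε A b) (h0 : 0 < ε) (h1 : ε ≤ 1) :
    ∀ᵐ ω ∂μ, ∃ k, orderedReward θ ξ b ω k ∈ Set.Ici (1 - ε) :=
  SatisficingBandit.ae_exists_orderedReward_mem h.toIsDeterministicBandit h.measurable_order
    h.injective_order h0 h1

lemma ae_firstSatisfactory_eq (h : IsSequentialSearch μ θ ξ ε A b) (h0 : 0 < ε) (h1 : ε ≤ 1) :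
    ∀ᵐ ω ∂μ, firstSatisfactory θ A ε ω =
      entryTime (Set.Ici (1 - ε)) (orderedReward θ ξ b ω) := by
  filter_upwards [h.action_eq, h.ae_exists_orderedReward_mem h0 h1] with ω hA hex
  calc firstSatisfactory θ A ε ω
      = entryTime (Set.Ici (1 - ε)) fun t => θ (A t ω) ω := rfl
    _ = entryTime (Set.Ici (1 - ε)) fun t => orderedReward θ ξ b ω
          (min t (entryTime (Set.Ici (1 - ε)) (orderedReward θ ξ b ω))) := by
        simp only [hA, orderedReward]
    _ = _ := entryTime_apply_min_entryTime hex

lemma ae_action_eq (h : IsSequentialSearch μ θ ξ ε A b) (h0 : 0 < ε) (h1 : ε ≤ 1) :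
    ∀ᵐ ω ∂μ, ∀ t, A t ω = b (ξ ω) (min t (firstSatisfactory θ A ε ω)) := by
  filter_upwards [h.action_eq, h.ae_firstSatisfactory_eq h0 h1] with ω hA hτ
  rwa [hτ]

lemma ae_benchmark_eq (h : IsSequentialSearch μ θ ξ ε A b) (h0 : 0 < ε) (h1 : ε ≤ 1) :
    ∀ᵐ ω ∂μ, benchmark θ A ε ω = b (ξ ω) (firstSatisfactory θ A ε ω) := by
  filter_upwards [h.ae_action_eq h0 h1] with ω hA
  rw [benchmark, hA, min_self]

theorem ae_exists_satisfactory (h : IsSequentialSearch μ θ ξ ε A b) (h0 : 0 < ε) (h1 : ε ≤ 1) :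
    ∀ᵐ ω ∂μ, ∃ t, 1 - ε ≤ θ (A t ω) ω := by
  filter_upwards [h.ae_benchmark_eq h0 h1, h.ae_firstSatisfactory_eq h0 h1,
    h.ae_exists_orderedReward_mem h0 h1] with ω hbench hτ hex
  refine ⟨firstSatisfactory θ A ε ω, ?_⟩
  change 1 - ε ≤ θ (benchmark θ A ε ω) ω
  rw [hbench, hτ]
  exact apply_entryTime_mem hex

theorem map_firstSatisfactory {ε : unitInterval} (h : IsSequentialSearch μ θ ξ ε A b)
    (h0 : 0 < ε) : μ.map (firstSatisfactory θ A ε) = geometricMeasure ε := by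
  have hS : unitUniform (Set.Ici (1 - ε : ℝ)) = ENNReal.ofReal ε := by
    rw [unitUniform_Ici (sub_nonneg.2 ε.2.2), sub_sub_cancel]
  rw [← map_entryTime_iidLaw measurableSet_Ici h0.ne' hS, ← rewardLaw,
    ← h.map_orderedReward h.measurable_order h.injective_order,
    Measure.map_map (measurable_entryTime measurableSet_Ici)
      (h.measurable_orderedReward h.measurable_order)]
  exact Measure.map_congr (h.ae_firstSatisfactory_eq h0 ε.2.2)

theorem entropy_firstSatisfactory {ε : unitInterval} (h : IsSequentialSearch μ θ ξ ε A b)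
    (h0 : 0 < ε) (h1 : ε < 1) :
    entropy μ (firstSatisfactory θ A ε) = ENNReal.ofReal (Real.binEntropy ε / ε) := by
  rw [entropy, h.map_firstSatisfactory h0, entropyOfLaw_geometricMeasure h0 h1]

/-- Given the internal randomness, the benchmark action is a one-to-one function of the time at
which it is found. -/
theorem condEntropy_benchmark (h : IsSequentialSearch μ θ ξ ε A b) (h0 : 0 < ε) (h1 : ε ≤ 1) :
    condEntropy μ (benchmark θ A ε) ξ = entropy μ (firstSatisfactory θ A ε) := by
  have := Measure.isProbabilityMeasure_map (μ := μ) h.measurable_exogenous.aemeasurable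
  set σ := entryTime (Set.Ici (1 - ε))
  have hσ : Measurable σ := measurable_entryTime measurableSet_Ici
  have hX := h.measurable_orderedReward h.measurable_order
  have hbench : benchmark θ A ε =ᵐ[μ] fun ω => b (ξ ω) (σ (orderedReward θ ξ b ω)) := by
    filter_upwards [h.ae_benchmark_eq h0 h1, h.ae_firstSatisfactory_eq h0 h1] with ω hω hτ
    rw [hω, hτ]
  have hτ : μ.map (firstSatisfactory θ A ε) = (μ.map (orderedReward θ ξ b)).map σ := by
    rw [Measure.map_map hσ hX]
    exact Measure.map_congr (h.ae_firstSatisfactory_eq h0 h1)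
  have hcond := condDistrib_comp_of_indepFun (g := fun p : Ξ × (ℕ → ℝ) => b p.1 (σ p.2))
    h.measurable_exogenous hX
    (h.indepFun_exogenous_orderedReward h.measurable_order h.injective_order)
    (measurable_apply_nat (fun k => (h.measurable_order k).comp measurable_fst)
      (hσ.comp measurable_snd))
  have hlaw (z : Ξ) : entropyOfLaw ((μ.map (orderedReward θ ξ b)).map fun x => b z (σ x)) =
      entropy μ (firstSatisfactory θ A ε) := by
    rw [entropy, hτ, ← entropyOfLaw_map_of_injective ((μ.map (orderedReward θ ξ b)).map σ)
      (h.injective_order z), Measure.map_map .of_discrete hσ]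
    rfl
  rw [condEntropy, condDistrib_congr_left hbench,
    lintegral_congr_ae (hcond.mono fun z hz => (congrArg entropyOfLaw hz).trans (hlaw z))]
  simp

end IsSequentialSearch

/-! ### Posterior distributions along the search -/

namespace IsSequentialSearch

variable {t : ℕ} [IsProbabilityMeasure μ]

lemma map_remainingReward (h : IsSequentialSearch μ θ ξ ε A b) (t : ℕ) :
    μ.map (remainingReward θ ξ b t) = rewardLaw := by
  have hshift : Measurable fun (x : ℕ → ℝ) j => x (t + j) := by fun_prop
  calc μ.map (remainingReward θ ξ b t)
      = (μ.map (orderedReward θ ξ b)).map fun x j => x (t + j) :=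
        (Measure.map_map hshift (h.measurable_orderedReward h.measurable_order)).symm
    _ = rewardLaw := by
        rw [h.map_orderedReward h.measurable_order h.injective_order]
        exact map_comp_iidLaw (add_right_injective t)

lemma indepFun_searchHistory_remainingReward (h : IsSequentialSearch μ θ ξ ε A b) (t : ℕ) :
    IndepFun (fun ω => (searchHistory θ ξ b t ω, ξ ω)) (remainingReward θ ξ b t) μ := by
  have hprefix : Measurable fun (x : ℕ → ℝ) (k : Fin t) => x k := by fun_prop
  have hshift : Measurable fun (x : ℕ → ℝ) j => x (t + j) := by fun_prop
  have hrewards : IndepFun (fun (x : ℕ → ℝ) (k : Fin t) => x k) (fun x j => x (t + j))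
      (μ.map (orderedReward θ ξ b)) := by
    rw [h.map_orderedReward h.measurable_order h.injective_order]
    exact indepFun_prefix_shift_iidLaw t
  have hindep := indepFun_prodMk_comp h.measurable_exogenous
    (h.measurable_orderedReward h.measurable_order)
    (h.indepFun_exogenous_orderedReward h.measurable_order h.injective_order) hprefix hshift
    hrewards
  have hhistory : Measurable fun p : Ξ × (Fin t → ℝ) =>
      ((fun k : Fin t => (b p.1 k, p.2 k) : History t), p.1) :=
    (measurable_pi_iff.2 fun k : Fin t => ((h.measurable_order k).comp measurable_fst).prodMk
      ((measurable_pi_apply k).comp measurable_snd)).prodMk measurable_fst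
  exact hindep.comp hhistory measurable_id

lemma ae_history_mem_iff (h : IsSequentialSearch μ θ ξ ε A b) (h0 : 0 < ε) (h1 : ε ≤ 1) :
    ∀ᵐ ω ∂μ, history θ A t ω ∈ unsatisfactoryHistories ε t ↔ t ≤ firstSatisfactory θ A ε ω := by
  filter_upwards [h.ae_exists_satisfactory h0 h1] with ω hex
  exact Fin.forall_iff.trans (le_entryTime_iff hex).symm

lemma ae_searchHistory_mem_iff (h : IsSequentialSearch μ θ ξ ε A b) (h0 : 0 < ε) (h1 : ε ≤ 1) :
    ∀ᵐ ω ∂μ, searchHistory θ ξ b t ω ∈ unsatisfactoryHistories ε t ↔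
      t ≤ firstSatisfactory θ A ε ω := by
  filter_upwards [h.ae_exists_orderedReward_mem h0 h1, h.ae_firstSatisfactory_eq h0 h1]
    with ω hex hτ
  rw [hτ]
  exact Fin.forall_iff.trans (le_entryTime_iff hex).symm

lemma ae_history_eq_searchHistory (h : IsSequentialSearch μ θ ξ ε A b) (h0 : 0 < ε) (h1 : ε ≤ 1) :
    ∀ᵐ ω ∂μ, t ≤ firstSatisfactory θ A ε ω → history θ A t ω = searchHistory θ ξ b t ω := by
  filter_upwards [h.ae_action_eq h0 h1] with ω hA ht
  funext k
  simp only [history, searchHistory, orderedReward, hA k, min_eq_left (k.2.le.trans ht)]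

lemma ae_reward_action_eq (h : IsSequentialSearch μ θ ξ ε A b) (h0 : 0 < ε) (h1 : ε ≤ 1) :
    ∀ᵐ ω ∂μ, t ≤ firstSatisfactory θ A ε ω →
      θ (A t ω) ω = remainingReward θ ξ b t ω 0 := by
  filter_upwards [h.ae_action_eq h0 h1] with ω hA ht
  rw [hA, min_eq_left ht]
  rfl

lemma ae_firstSatisfactory_eq_add (h : IsSequentialSearch μ θ ξ ε A b) (h0 : 0 < ε) (h1 : ε ≤ 1) :
    ∀ᵐ ω ∂μ, t ≤ firstSatisfactory θ A ε ω → firstSatisfactory θ A ε ω =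
      t + entryTime (Set.Ici (1 - ε)) (remainingReward θ ξ b t ω) := by
  filter_upwards [h.ae_firstSatisfactory_eq h0 h1, h.ae_exists_orderedReward_mem h0 h1]
    with ω hτ hex ht
  rw [hτ] at ht ⊢
  exact (add_entryTime_shift hex ht).symm

lemma ae_reward_benchmark_sub_eq_searchGain (h : IsSequentialSearch μ θ ξ ε A b) (h0 : 0 < ε)
    (h1 : ε ≤ 1) :
    ∀ᵐ ω ∂μ, t ≤ firstSatisfactory θ A ε ω → θ (benchmark θ A ε ω) ω - θ (A t ω) ω =
      searchGain (Set.Ici (1 - ε)) (remainingReward θ ξ b t ω) := by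
  filter_upwards [h.ae_benchmark_eq h0 h1, h.ae_firstSatisfactory_eq_add h0 h1,
    h.ae_reward_action_eq h0 h1] with ω hbench hτ hreward ht
  rw [hreward ht, hbench, hτ ht]
  rfl

lemma ae_benchmark_eq_action (h : IsSequentialSearch μ θ ξ ε A b) (h0 : 0 < ε) (h1 : ε ≤ 1) :
    ∀ᵐ ω ∂μ, firstSatisfactory θ A ε ω < t → benchmark θ A ε ω = A t ω := by
  filter_upwards [h.ae_action_eq h0 h1, h.ae_benchmark_eq h0 h1] with ω hA hbench ht
  rw [hbench, hA, min_eq_right ht.le]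

/-- Before a satisfactory action has been found, the observed rewards tell nothing about the
remaining ones, in the order given by the internal randomness. -/
lemma ae_condDistrib_history_eq {T : Type*} [MeasurableSpace T] [StandardBorelSpace T] [Nonempty T]
    [StandardBorelSpace Ξ] [Nonempty Ξ] (h : IsSequentialSearch μ θ ξ ε A b) (h0 : 0 < ε)
    (h1 : ε ≤ 1) {W : Ω → T} (hW : Measurable W) {g : Ξ × (ℕ → ℝ) → T} (hg : Measurable g)
    (hWg : ∀ᵐ ω ∂μ, t ≤ firstSatisfactory θ A ε ω → W ω = g (ξ ω, remainingReward θ ξ b t ω)) :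
    ∀ᵐ ω ∂μ, history θ A t ω ∈ unsatisfactoryHistories ε t →
      condDistrib W (history θ A t) μ (history θ A t ω) =
        ((condDistrib ξ (searchHistory θ ξ b t) μ (history θ A t ω)).prod rewardLaw).map g := by
  have hF' := h.measurable_searchHistory t
  have hξ := h.measurable_exogenous
  have hV := h.measurable_remainingReward t
  have hlocal := condDistrib_ae_eq_of_agree (W' := fun ω => g (ξ ω, remainingReward θ ξ b t ω))
    (h.measurable_history t) hF' hW
    (hg.comp (hξ.prodMk hV)) (measurableSet_unsatisfactoryHistories ε t)
    (by filter_upwards [h.ae_history_mem_iff h0 h1, h.ae_searchHistory_mem_iff h0 h1]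
          with ω h₁ h₂ using h₁.trans h₂.symm)
    (by filter_upwards [h.ae_history_mem_iff h0 h1, h.ae_history_eq_searchHistory h0 h1, hWg]
          with ω hmem hF hW hN using ⟨hF (hmem.1 hN), hW (hmem.1 hN)⟩)
  have hproduct := ae_of_ae_map hF'.aemeasurable (condDistrib_prodMk_of_indepFun hF' hξ hV
    (h.indepFun_searchHistory_remainingReward t))
  have hcomp := ae_of_ae_map hF'.aemeasurable
    (condDistrib_comp (μ := μ) (searchHistory θ ξ b t) (hξ.prodMk hV).aemeasurable hg)
  filter_upwards [hlocal, hproduct, hcomp, h.ae_history_mem_iff h0 h1,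
    h.ae_history_eq_searchHistory h0 h1] with ω hlocal hproduct hcomp hmem hF hN
  rw [hlocal hN, hF (hmem.1 hN)]
  refine hcomp.trans ?_
  rw [Kernel.map_apply _ hg, hproduct, h.map_remainingReward]

theorem ae_expectedShortfall_eq_integral_searchGain [StandardBorelSpace Ξ] [Nonempty Ξ]
    (h : IsSequentialSearch μ θ ξ ε A b) (h0 : 0 < ε) (h1 : ε ≤ 1) (t : ℕ) :
    ∀ᵐ ω ∂μ, history θ A t ω ∈ unsatisfactoryHistories ε t →
      expectedShortfall μ θ A (benchmark θ A ε) t ω =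
        ∫ x, searchGain (Set.Ici (1 - ε)) x ∂rewardLaw := by
  set D : Ω → ℝ := fun ω => θ (benchmark θ A ε ω) ω - θ (A t ω) ω with hD
  have hDmeas : Measurable D :=
    (measurable_apply_nat (f := fun ω a => θ a ω) h.measurable_reward h.measurable_benchmark).sub
      (h.measurable_reward_action t)
  have hDint : Integrable D μ := by
    refine .of_mem_Icc (-1) 1 hDmeas.aemeasurable ?_
    filter_upwards [h.ae_reward_mem_Icc] with ω hω
    have hbench := hω (benchmark θ A ε ω)
    have haction := hω (A t ω)
    exact ⟨by linarith [hbench.1, haction.2], by linarith [hbench.2, haction.1]⟩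
  have hgain := measurable_searchGain (measurableSet_Ici (a := 1 - ε))
  have hcond := h.ae_condDistrib_history_eq h0 h1 hDmeas (hgain.comp measurable_snd)
    (h.ae_reward_benchmark_sub_eq_searchGain h0 h1 (t := t))
  filter_upwards [hcond, condExp_ae_eq_integral_condDistrib' (h.measurable_history t) hDint]
    with ω hcond hexp hN
  have hsnd := measurePreserving_snd
    (μ := condDistrib ξ (searchHistory θ ξ b t) μ (history θ A t ω)) (ν := rewardLaw)
  rw [expectedShortfall, ← hD, hexp, hcond hN, ← Measure.map_map hgain measurable_snd,
    hsnd.map_eq]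
  exact integral_map hgain.aemeasurable aestronglyMeasurable_id

theorem ae_expectedShortfall_eq_zero (h : IsSequentialSearch μ θ ξ ε A b) (h0 : 0 < ε)
    (h1 : ε ≤ 1) (t : ℕ) :
    ∀ᵐ ω ∂μ, history θ A t ω ∉ unsatisfactoryHistories ε t →
      expectedShortfall μ θ A (benchmark θ A ε) t ω = 0 := by
  have hN := (measurableSet_unsatisfactoryHistories ε t).compl
  refine (ae_restrict_iff' (h.measurable_history t hN)).1
    (condExp_ae_eq_restrict_zero ⟨_, hN, rfl⟩ ?_)
  refine (ae_restrict_iff' (h.measurable_history t hN)).2 ?_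
  filter_upwards [h.ae_history_mem_iff h0 h1, h.ae_benchmark_eq_action h0 h1] with ω hmem hbench hω
  rw [hbench (not_le.1 (mt hmem.2 hω)), sub_self]
  rfl

end IsSequentialSearch

/-! ### Information about the benchmark gained by one more observation -/

lemma ofReal_binEntropy_le_klDiv {b : ℕ → ℕ} (hb : Function.Injective b) {ε : ℝ} (h0 : 0 < ε)
    (h1 : ε ≤ 1) (t : ℕ) {ρ : Measure (ℕ × ℝ)}
    (hρ : ρ = rewardLaw.map fun x => (b (t + entryTime (Set.Ici (1 - ε)) x), x 0)) :
    ENNReal.ofReal (Real.binEntropy ε) ≤ klDiv ρ (ρ.fst.prod ρ.snd) := by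
  have hpre : (fun y : ℝ => decide (y ∈ Set.Ici (1 - ε))) ⁻¹' {true} = Set.Ici (1 - ε) := by
    ext; simp
  have hfirst : Measurable fun a : ℕ => decide (a = b t) := .of_discrete
  have hfound : Measurable fun y : ℝ => decide (y ∈ Set.Ici (1 - ε)) :=
    measurable_to_bool (by rw [hpre]; exact measurableSet_Ici)
  have hpair : Measurable fun x : ℕ → ℝ => (b (t + entryTime (Set.Ici (1 - ε)) x), x 0) :=
    (Measurable.of_discrete (f := fun n => b (t + n)).comp
      (measurable_entryTime measurableSet_Ici)).prodMk (measurable_pi_apply 0)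
  have : IsProbabilityMeasure ρ := hρ ▸ Measure.isProbabilityMeasure_map hpair.aemeasurable
  have hagree : ∀ᵐ p ∂ρ, decide (p.1 = b t) = decide (p.2 ∈ Set.Ici (1 - ε)) := by
    have hset : MeasurableSet
        {p : ℕ × ℝ | decide (p.1 = b t) = decide (p.2 ∈ Set.Ici (1 - ε))} :=
      measurableSet_eq_fun (hfirst.comp measurable_fst)
        (hfound.comp measurable_snd)
    rw [hρ, ae_map_iff hpair.aemeasurable hset]
    filter_upwards [ae_exists_mem_Ici_rewardLaw (sub_nonneg.2 h1) (sub_lt_self 1 h0)] with x hx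
    rw [decide_eq_decide, hb.eq_iff, Nat.add_eq_left, entryTime_eq_iff hx]
    simp
  have hsnd : ρ.snd = unitUniform := by
    rw [hρ, Measure.snd, Measure.map_map measurable_snd hpair]
    exact (measurePreserving_eval_iidLaw 0).map_eq
  have := Measure.isProbabilityMeasure_map (μ := ρ.snd) hfound.aemeasurable
  refine le_of_eq_of_le ?_ (entropyOfLaw_le_klDiv_fst_prod_snd ρ hfirst hfound hagree)
  rw [entropyOfLaw_bool, measureReal_def, Measure.map_apply hfound (measurableSet_singleton _),
    hsnd]
  rw [hpre, unitUniform_Ici (sub_nonneg.2 h1), sub_sub_cancel, ENNReal.toReal_ofReal h0.le]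

namespace IsSequentialSearch

variable [IsProbabilityMeasure μ] [StandardBorelSpace Ξ] [Nonempty Ξ]

theorem ae_le_informationGain (h : IsSequentialSearch μ θ ξ ε A b) (h0 : 0 < ε) (h1 : ε ≤ 1)
    (t : ℕ) :
    ∀ᵐ ω ∂μ, history θ A t ω ∈ unsatisfactoryHistories ε t →
      ENNReal.ofReal (Real.binEntropy ε) ≤ informationGain μ θ ξ A (benchmark θ A ε) t ω := by
  have hg : Measurable fun p : Ξ × (ℕ → ℝ) =>
      (b p.1 (t + entryTime (Set.Ici (1 - ε)) p.2), p.2 0) :=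
    (measurable_apply_nat (f := fun p : Ξ × (ℕ → ℝ) => b p.1)
      (fun k => (h.measurable_order k).comp measurable_fst)
      (((measurable_entryTime measurableSet_Ici).comp measurable_snd).const_add t)).prodMk
      ((measurable_pi_apply 0).comp measurable_snd)
  have hW : ∀ᵐ ω ∂μ, t ≤ firstSatisfactory θ A ε ω →
      (ξ ω, benchmark θ A ε ω, θ (A t ω) ω) =
        (ξ ω, b (ξ ω) (t + entryTime (Set.Ici (1 - ε)) (remainingReward θ ξ b t ω)),
          remainingReward θ ξ b t ω 0) := by
    filter_upwards [h.ae_benchmark_eq h0 h1, h.ae_firstSatisfactory_eq_add h0 h1,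
      h.ae_reward_action_eq h0 h1] with ω hbench hτ hreward ht
    rw [hreward ht, hbench, ← hτ ht]
  filter_upwards [h.ae_condDistrib_history_eq h0 h1
    (h.measurable_exogenous.prodMk (h.measurable_benchmark.prodMk (h.measurable_reward_action t)))
    (measurable_fst.prodMk hg) hW] with ω hcond hN
  simp only [informationGain, hcond hN]
  rw [condMutualInfoOfLaw_map_prodMk _ _ hg]
  calc ENNReal.ofReal (Real.binEntropy ε)
      = ∫⁻ _, ENNReal.ofReal (Real.binEntropy ε)
          ∂condDistrib ξ (searchHistory θ ξ b t) μ (history θ A t ω) := by simp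
    _ ≤ _ := lintegral_mono fun z => ofReal_binEntropy_le_klDiv (h.injective_order z) h0 h1 t rfl

lemma ae_ofReal_sq_div_informationGain_le (h : IsSequentialSearch μ θ ξ ε A b) (h0 : 0 < ε)
    (h1 : ε ≤ 1) (t : ℕ) :
    ∀ᵐ ω ∂μ, ENNReal.ofReal (expectedShortfall μ θ A (benchmark θ A ε) t ω ^ 2) /
      informationGain μ θ ξ A (benchmark θ A ε) t ω ≤
        ENNReal.ofReal (1 / 4) / ENNReal.ofReal (Real.binEntropy ε) := by
  filter_upwards [h.ae_expectedShortfall_eq_integral_searchGain h0 h1 t,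
    h.ae_expectedShortfall_eq_zero h0 h1 t, h.ae_le_informationGain h0 h1 t]
    with ω hgain hzero hinfo
  by_cases hN : history θ A t ω ∈ unsatisfactoryHistories ε t
  · rw [hgain hN]
    obtain ⟨hnonneg, hhalf⟩ :=
      integral_searchGain_mem_Icc (sub_nonneg.2 h1) (sub_lt_self (1 : ℝ) h0)
    exact ENNReal.div_le_div (ENNReal.ofReal_le_ofReal (by nlinarith)) (hinfo hN)
  · simp [hzero hN]

end IsSequentialSearch

lemma ofReal_one_sub_mul_tsum_pow {r : ℝ} (h0 : 0 ≤ r) (h1 : r < 1) :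
    ENNReal.ofReal (1 - r) * ∑' t : ℕ, ENNReal.ofReal (r ^ t) = 1 := by
  rw [← ENNReal.ofReal_tsum_of_nonneg (pow_nonneg h0) (summable_geometric_of_lt_one h0 h1),
    tsum_geometric_of_lt_one h0 h1, ← ENNReal.ofReal_mul (sub_nonneg.2 h1.le),
    mul_inv_cancel₀ (sub_pos.2 h1).ne', ENNReal.ofReal_one]

namespace IsSequentialSearch

variable [IsProbabilityMeasure μ] [StandardBorelSpace Ξ] [Nonempty Ξ]

theorem informationRatio_le {ε : unitInterval} (h : IsSequentialSearch μ θ ξ ε A b) (h0 : 0 < ε)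
    (h1 : ε < 1) {α : ℝ} (hα : α ^ 2 < 1) :
    informationRatio μ θ ξ α (benchmark θ A ε) A ≤
      1 / (4 * ENNReal.ofReal ε * entropy μ (firstSatisfactory θ A ε)) := by
  have hε : (0 : ℝ) < ε := h0
  have hbin : 0 < Real.binEntropy ε := Real.binEntropy_pos h0 h1
  set C : ℝ≥0∞ := ENNReal.ofReal (1 / 4) / ENNReal.ofReal (Real.binEntropy ε) with hC
  have hterm (t : ℕ) : ∫⁻ ω, ENNReal.ofReal (expectedShortfall μ θ A (benchmark θ A ε) t ω ^ 2) /
      informationGain μ θ ξ A (benchmark θ A ε) t ω ∂μ ≤ C :=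
    (lintegral_mono_ae (h.ae_ofReal_sq_div_informationGain_le h0 ε.2.2 t)).trans (by simp [hC])
  calc informationRatio μ θ ξ α (benchmark θ A ε) A
      ≤ ENNReal.ofReal (1 - α ^ 2) * ∑' t : ℕ, ENNReal.ofReal ((α ^ 2) ^ t) * C := by
        simp_rw [informationRatio, pow_mul]
        gcongr with t
        exact hterm t
    _ = C := by
        rw [ENNReal.tsum_mul_right, ← mul_assoc, ofReal_one_sub_mul_tsum_pow (sq_nonneg α) hα,
          one_mul]
    _ = ENNReal.ofReal (1 / (4 * ε * (Real.binEntropy ε / ε))) := by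
        rw [hC, ← ENNReal.ofReal_div_of_pos hbin]
        congr 1
        field_simp
    _ = _ := by
        rw [h.entropy_firstSatisfactory h0 h1, ENNReal.ofReal_div_of_pos (by positivity),
          ENNReal.ofReal_mul (by positivity), ENNReal.ofReal_mul (by positivity)]
        simp

end IsSequentialSearch

/-! ### Discounted regret -/

section DiscountedSum

variable {α C : ℝ}

lemma abs_pow_mul_le {u : ℕ → ℝ} (hu : ∀ t, |u t| ≤ C) (t : ℕ) :
    |α ^ t * u t| ≤ |α| ^ t * C := by
  rw [abs_mul, abs_pow]
  exact mul_le_mul_of_nonneg_left (hu t) (pow_nonneg (abs_nonneg α) t)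

lemma summable_pow_mul (hα : |α| < 1) {u : ℕ → ℝ} (hu : ∀ t, |u t| ≤ C) :
    Summable fun t => α ^ t * u t :=
  .of_norm_bounded ((summable_geometric_of_lt_one (abs_nonneg α) hα).mul_right C)
    (abs_pow_mul_le hu)

variable {Ω : Type*} [MeasurableSpace Ω] {μ : Measure Ω} [IsFiniteMeasure μ] {f : ℕ → Ω → ℝ}

lemma integrable_tsum_pow_mul (hα : |α| < 1) (hf : ∀ t, AEStronglyMeasurable (f t) μ)
    (hC : ∀ᵐ ω ∂μ, ∀ t, |f t ω| ≤ C) : Integrable (fun ω => ∑' t, α ^ t * f t ω) μ := by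
  refine .of_bound (C := (1 - |α|)⁻¹ * C)
    (aestronglyMeasurable_of_tendsto_ae Filter.atTop
      (f := fun n ω => ∑ t ∈ Finset.range n, α ^ t * f t ω) (fun n => ?_) ?_) ?_
  · exact Finset.aestronglyMeasurable_fun_sum _ fun t _ => (hf t).const_mul _
  · filter_upwards [hC] with ω hω using (summable_pow_mul hα hω).hasSum.tendsto_sum_nat
  · filter_upwards [hC] with ω hω
    exact tsum_of_norm_bounded ((hasSum_geometric_of_lt_one (abs_nonneg α) hα).mul_right C)
      (abs_pow_mul_le hω)

lemma hasSum_pow_mul_integral (hα : |α| < 1) (hf : ∀ t, AEStronglyMeasurable (f t) μ)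
    (hC : ∀ᵐ ω ∂μ, ∀ t, |f t ω| ≤ C) :
    HasSum (fun t => α ^ t * ∫ ω, f t ω ∂μ) (∫ ω, ∑' t, α ^ t * f t ω ∂μ) := by
  have hgeom := (summable_geometric_of_lt_one (abs_nonneg α) hα).mul_right C
  simp_rw [← integral_const_mul]
  refine hasSum_integral_of_dominated_convergence (fun t _ => |α| ^ t * C)
    (fun t => (hf t).const_mul _) (fun t => ?_) (.of_forall fun _ => hgeom)
    (integrable_const _) ?_
  · filter_upwards [hC] with ω hω using abs_pow_mul_le hω t
  · filter_upwards [hC] with ω hω using (summable_pow_mul hα hω).hasSum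

end DiscountedSum

/-- The regret `R* - R_{t,A_t}` incurred in period `t`. -/
def regret (θ : ℕ → Ω → ℝ) (A : ℕ → Ω → ℕ) (t : ℕ) (ω : Ω) : ℝ := optReward θ ω - θ (A t ω) ω

namespace IsSequentialSearch

lemma ae_abs_regret_le_one (h : IsSequentialSearch μ θ ξ ε A b) :
    ∀ᵐ ω ∂μ, ∀ t, |regret θ A t ω| ≤ 1 := by
  filter_upwards [h.ae_optReward_eq_one, h.ae_reward_mem_Icc] with ω hopt hθ t
  obtain ⟨hnonneg, hle⟩ := hθ (A t ω)
  rw [regret, hopt, abs_of_nonneg (sub_nonneg.2 hle)]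
  exact sub_le_self 1 hnonneg

lemma measurable_regret (h : IsSequentialSearch μ θ ξ ε A b) (t : ℕ) :
    Measurable (regret θ A t) :=
  (Measurable.iSup h.measurable_reward).sub (h.measurable_reward_action t)

lemma ae_summable_regret (h : IsSequentialSearch μ θ ξ ε A b) {α : ℝ} (hα : |α| < 1) :
    ∀ᵐ ω ∂μ, Summable fun t => α ^ t * regret θ A t ω :=
  h.ae_abs_regret_le_one.mono fun _ hω => summable_pow_mul hα hω

variable [IsProbabilityMeasure μ]

lemma integrable_tsum_regret (h : IsSequentialSearch μ θ ξ ε A b) {α : ℝ} (hα : |α| < 1) :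
    Integrable (fun ω => ∑' t, α ^ t * regret θ A t ω) μ :=
  integrable_tsum_pow_mul hα (fun t => (h.measurable_regret t).aestronglyMeasurable)
    h.ae_abs_regret_le_one

lemma integral_regret_le (h : IsSequentialSearch μ θ ξ ε A b) (h0 : 0 < ε) (h1 : ε ≤ 1) (t : ℕ) :
    ∫ ω, regret θ A t ω ∂μ ≤ ε + (1 - ε) ^ t / 2 := by
  have hregret : regret θ A t =ᵐ[μ] fun ω => 1 - orderedReward θ ξ b ω
      (min t (entryTime (Set.Ici (1 - ε)) (orderedReward θ ξ b ω))) := by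
    filter_upwards [h.ae_optReward_eq_one, h.action_eq] with ω hopt hA
    rw [regret, hopt, hA]
    rfl
  calc ∫ ω, regret θ A t ω ∂μ
      = ∫ x, (1 - x (min t (entryTime (Set.Ici (1 - ε)) x))) ∂rewardLaw := by
        rw [integral_congr_ae hregret, ← h.map_orderedReward h.measurable_order h.injective_order,
          integral_map (h.measurable_orderedReward h.measurable_order).aemeasurable
            ((measurable_apply_min_entryTime t).const_sub 1).aestronglyMeasurable]
    _ ≤ 1 - (1 - ε) + (1 - ε) ^ t / 2 :=
        integral_one_sub_apply_min_entryTime_le (sub_nonneg.2 h1) (sub_lt_self 1 h0) t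
    _ = ε + (1 - ε) ^ t / 2 := by rw [sub_sub_cancel]

theorem integral_tsum_regret_le (h : IsSequentialSearch μ θ ξ ε A b) (h0 : 0 < ε) (h1 : ε ≤ 1)
    {α : ℝ} (hα : α ∈ Set.Ico (0 : ℝ) 1) :
    ∫ ω, ∑' t, α ^ t * regret θ A t ω ∂μ ≤ ε / (1 - α) + 1 / (2 * ε) := by
  have hterm (t : ℕ) : α ^ t * ∫ ω, regret θ A t ω ∂μ ≤ α ^ t * ε + (1 - ε) ^ t / 2 := by
    have hpow : 0 ≤ (1 - ε) ^ t / 2 := by have := pow_nonneg (sub_nonneg.2 h1) t; positivity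
    calc α ^ t * ∫ ω, regret θ A t ω ∂μ
        ≤ α ^ t * (ε + (1 - ε) ^ t / 2) :=
          mul_le_mul_of_nonneg_left (h.integral_regret_le h0 h1 t) (pow_nonneg hα.1 t)
      _ ≤ α ^ t * ε + (1 - ε) ^ t / 2 := by
          rw [mul_add]
          gcongr
          exact mul_le_of_le_one_left hpow (pow_le_one₀ hα.1 hα.2.le)
  have hgeom := ((hasSum_geometric_of_lt_one hα.1 hα.2).mul_right ε).add
    ((hasSum_geometric_of_lt_one (sub_nonneg.2 h1) (sub_lt_self 1 h0)).div_const 2)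
  refine (hasSum_le hterm (hasSum_pow_mul_integral (abs_lt.2 ⟨by linarith [hα.1], hα.2⟩)
    (fun t => (h.measurable_regret t).aestronglyMeasurable) h.ae_abs_regret_le_one)
    hgeom).trans_eq ?_
  rw [sub_sub_cancel, inv_mul_eq_div, mul_comm 2 ε, one_div, mul_inv, div_eq_mul_inv ε⁻¹]

end IsSequentialSearch

end SequentialSearch

end SatisficingBandit

end

lemma div_one_sub_add_eq_sqrt {α ε : ℝ} (hα : α < 1) (hε : ε = √((1 - α) / 2)) :
    ε / (1 - α) + 1 / (2 * ε) = √(2 / (1 - α)) := by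
  have hpos : 0 < ε := hε ▸ Real.sqrt_pos.2 (half_pos (sub_pos.2 hα))
  have hsq : ε ^ 2 = (1 - α) / 2 := by
    rw [hε, Real.sq_sqrt (half_pos (sub_pos.2 hα)).le]
  have hinv : √(2 / (1 - α)) = ε⁻¹ := by rw [hε, ← Real.sqrt_inv, inv_div]
  have hα2 : 1 - α = 2 * ε ^ 2 := by linarith
  rw [hinv, hα2]
  field_simp
  norm_num

open SatisficingBandit in
theorem mainTheorem3_general {Ω Ξ : Type*} [MeasurableSpace Ω] [MeasurableSpace Ξ]
    [StandardBorelSpace Ξ] [Nonempty Ξ] (μ : Measure Ω) [IsProbabilityMeasure μ]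
    (θ : ℕ → Ω → ℝ) (ξ : Ω → Ξ) (hB : IsDeterministicBandit μ θ ξ)
    (α : ℝ) (hα : α ∈ Set.Ico (0 : ℝ) 1)
    (ε : unitInterval) (hε : (ε : ℝ) ∈ Set.Ioo (0 : ℝ) 1)
    (A : ℕ → Ω → ℕ) (hA : IsSTS μ θ ξ ε A) :
    (∀ᵐ ω ∂μ, ∃ t, 1 - (ε : ℝ) ≤ θ (A t ω) ω) ∧
    μ.map (firstSatisfactory θ A ε) = geometricMeasure ε ∧
    0 < entropy μ (firstSatisfactory θ A ε) ∧ entropy μ (firstSatisfactory θ A ε) < ∞ ∧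
    condEntropy μ (benchmark θ A ε) ξ = entropy μ (firstSatisfactory θ A ε) ∧
    informationRatio μ θ ξ α (benchmark θ A ε) A ≤
      1 / (4 * ENNReal.ofReal ε * entropy μ (firstSatisfactory θ A ε)) ∧
    (∀ᵐ ω ∂μ, Summable fun t : ℕ => α ^ t * (optReward θ ω - θ (A t ω) ω)) ∧
    Integrable (fun ω => ∑' t : ℕ, α ^ t * (optReward θ ω - θ (A t ω) ω)) μ ∧
    ∫ ω, ∑' t : ℕ, α ^ t * (optReward θ ω - θ (A t ω) ω) ∂μ ≤ ε / (1 - α) + 1 / (2 * ε) := by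
  obtain ⟨h0, h1⟩ := hε
  have hα1 : |α| < 1 := abs_lt.2 ⟨by linarith [hα.1], hα.2⟩
  obtain ⟨b, h⟩ := hA.exists_isSequentialSearch hB h0 h1.le
  have hentropy := h.entropy_firstSatisfactory h0 h1
  refine ⟨h.ae_exists_satisfactory h0 h1.le, h.map_firstSatisfactory h0, ?_, ?_,
    h.condEntropy_benchmark h0 h1.le,
    h.informationRatio_le h0 h1 ((sq_lt_one_iff_abs_lt_one α).2 hα1),
    h.ae_summable_regret hα1, h.integrable_tsum_regret hα1, h.integral_tsum_regret_le h0 h1.le hα⟩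
  · rw [hentropy]
    exact ENNReal.ofReal_pos.2 (div_pos (Real.binEntropy_pos h0 h1) h0)
  · rw [hentropy]
    exact ENNReal.ofReal_lt_top

theorem mainTheorem3 {Ω Ξ : Type*} [MeasurableSpace Ω] [MeasurableSpace Ξ]
    [StandardBorelSpace Ξ] [Nonempty Ξ]
    (μ : Measure Ω) [IsProbabilityMeasure μ]
    (θ : ℕ → Ω → ℝ) (ξ : Ω → Ξ) (hB : SatisficingBandit.IsDeterministicBandit μ θ ξ)
    (α : ℝ) (hα : α ∈ Set.Ioo (0 : ℝ) 1)
    (ε : unitInterval) (hε : (ε : ℝ) ∈ Set.Ioo (0 : ℝ) 1)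
    (A : ℕ → Ω → ℕ) (hA : SatisficingBandit.IsSTS μ θ ξ ε A) :
    -- `τ` is almost surely finite and geometric on `{0, 1, 2, …}`, with positive finite entropy
    (∀ᵐ ω ∂μ, ∃ t, 1 - (ε : ℝ) ≤ θ (A t ω) ω) ∧
    μ.map (SatisficingBandit.firstSatisfactory θ A ε) = geometricMeasure ε ∧
    0 < SatisficingBandit.entropy μ (SatisficingBandit.firstSatisfactory θ A ε) ∧
    SatisficingBandit.entropy μ (SatisficingBandit.firstSatisfactory θ A ε) < ∞ ∧
    -- `H(Ã | ξ) = H(τ)`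
    SatisficingBandit.condEntropy μ (SatisficingBandit.benchmark θ A ε) ξ =
      SatisficingBandit.entropy μ (SatisficingBandit.firstSatisfactory θ A ε) ∧
    -- `Γ(Ã, {A_t}) ≤ 1 / (4 ε H(τ))`
    SatisficingBandit.informationRatio μ θ ξ α (SatisficingBandit.benchmark θ A ε) A ≤
      1 / (4 * ENNReal.ofReal ε *
        SatisficingBandit.entropy μ (SatisficingBandit.firstSatisfactory θ A ε)) ∧
    -- the bound on expected discounted regret
    ((ε : ℝ) = Real.sqrt ((1 - α) / 2) →
      (∀ᵐ ω ∂μ, Summable fun t : ℕ =>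
        α ^ t * (SatisficingBandit.optReward θ ω - θ (A t ω) ω)) ∧
      Integrable (fun ω => ∑' t : ℕ,
        α ^ t * (SatisficingBandit.optReward θ ω - θ (A t ω) ω)) μ ∧
      ∫ ω, ∑' t : ℕ, α ^ t * (SatisficingBandit.optReward θ ω - θ (A t ω) ω) ∂μ
        ≤ Real.sqrt (2 / (1 - α))) := by
  obtain ⟨hfinite, hlaw, hpos, hfin, hcond, hratio, hsum, hint, hregret⟩ :=
    mainTheorem3_general μ θ ξ hB α (Set.Ioo_subset_Ico_self hα) ε hε A hA
  exact ⟨hfinite, hlaw, hpos, hfin, hcond, hratio, fun hεα =>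
    ⟨hsum, hint, hregret.trans_eq (div_one_sub_add_eq_sqrt hα.2 hεα)⟩⟩
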